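/- **Setting.** Let $\mathcal S$ (messages), $\mathcal I$ (encoders), $\mathcal J$ (decoders) be finite sets, let $\mathcal A\subset\mathcal S\times\mathcal I$ be an access structure ($(s,i)\in\mathcal A$: encoder $i$ has access to message $s$), and let $\mathcal D(j)\subset\mathcal S$ be the set of messages to be reproduced by decoder $j$. Put $\mathcal I(s)=\{i:(s,i)\in\mathcal A\}$, $\mathcal S(i)=\{s:(s,i)\in\mathcal A\}$, and for $\mathcal I'\subset\mathcal I$ put $\mathcal S(\mathcal I')=\{s:\mathcal I(s)=\mathcal I'\}$; let $\mathfrak I=\{\mathcal I':\mathcal S(\mathcal I')\ne\emptyset\}$ and $\mathring{\mathcal S}(\mathcal I')=\bigcup_{\mathcal I''\in\mathfrak I,\ \mathcal I''\supsetneq\mathcal I'}\mathcal S(\mathcal I'')$. Enumerate $\mathfrak I=\{\mathcal I_1,\dots,\mathcal I_{|\mathfrak I|}\}$ so that $\mathcal I_k\subsetneq\mathcal I_{k'}$ implies $k'<k$. For a family $v=\{v_s\}_{s\in\mathcal S}$ and $\mathcal T\subset\mathcal S$ write $v_{\mathcal T}=\{v_s\}_{s\in\mathcal T}$. For every block length $n$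 let $Z^n_{\mathcal S}=\{Z^n_s\}_{s\in\mathcal S}$ have countable (finite or infinite) alphabets $\mathcal Z^n_s$ and a joint law with $$\mu_{Z^n_{\mathcal S}}(z_{\mathcal S})=\prod_{\mathcal I'\in\mathfrak I}\mu_{Z^n_{\mathcal S(\mathcal I')}|Z^n_{\mathring{\mathcal S}(\mathcal I')}}(z_{\mathcal S(\mathcal I')}|z_{\mathring{\mathcal S}(\mathcal I')});$$ given $Z^n_{\mathcal S}=z_{\mathcal S}$ let the channel inputs $X^n_i\in\mathcal X_i^n$ ($\mathcal X_i$ finite, $i\in\mathcal I$) be independent with laws $\mu_{X^n_i|Z^n_{\mathcal S(i)}}(\cdot|z_{\mathcal S(i)})$; and given also $X^n_{\mathcal I}$ let the channel outputs $Y^n_{\mathcal J}=\{Y^n_j\}_{j\in\mathcal J}$, with values in arbitrary measurable spaces, have the law $\mu_{Y^n_{\mathcal J}|X^n_{\mathcal I}}$ of an arbitrary channel. No consistency, stationarity or ergodicity in $n$ is assumed. Let $$\overline H(\mathbf U|\mathbf V)=\inf\Bigl\{\theta:\lim_{n\to\infty}\mathrm P\Bigl(\tfrac1n\log_2\tfrac1{\mu_{U_n|V_n}(U_n|V_n)}>\theta\Bigr)=0\Bigr\},\qquad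 \underline H(\mathbf U|\mathbf V)=\sup\Bigl\{\theta:\lim_{n\to\infty}\mathrm P\Bigl(\tfrac1n\log_2\tfrac1{\mu_{U_n|V_n}(U_n|V_n)}<\theta\Bigr)=0\Bigr\},$$ with values in the extended real line. **The code.** Let $\mathcal C^{(n)}_s$ and $\mathcal M^{(n)}_s$ be non-empty finite sets with $\frac1n\log_2|\mathcal C^{(n)}_s|\to r_s$ and $\frac1n\log_2|\mathcal M^{(n)}_s|\to R_s$, and let functions $f_s:\mathcal Z^n_s\to\mathcal C^{(n)}_s$, $g_s:\mathcal Z^n_s\to\mathcal M^{(n)}_s$ and elements $c_s\in\mathcal C^{(n)}_s$ be given. The messages $M_s$ are independent and uniform on $\mathcal M^{(n)}_s$. *Encoders:* for $k=1,\dots,|\mathfrak I|$ in this order, and given the previously generated $z_{\mathring{\mathcal S}(\mathcal I_k)}$, a constrained-random-number generator draws $z_{\mathcal S(\mathcal I_k)}$ from the law $\mu_{Z^n_{\mathcal S(\mathcal I_k)}|Z^n_{\mathring{\mathcal S}(\mathcal I_k)}}(\cdot|z_{\mathring{\mathcal S}(\mathcal I_k)})$ conditioned on the event that $f_s(z_s)=c_s$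 and $g_s(z_s)=M_s$ for all $s\in\mathcal S(\mathcal I_k)$; its output is shared by all encoders in $\mathcal I_k$, and an error is declared if this event has probability $0$. Encoder $i$, which takes part in the steps with $i\in\mathcal I_k$ and so knows $z_{\mathcal S(i)}$, sends a random $x_i$ with law $\mu_{X^n_i|Z^n_{\mathcal S(i)}}(\cdot|z_{\mathcal S(i)})$. *Decoders:* on the channel output $y_j$, decoder $j$ draws $\hat z_{\mathcal D(j)}$ from the law $\mu_{Z^n_{\mathcal D(j)}|Y^n_j}(\cdot|y_j)$ conditioned on the event that $f_s(\hat z_s)=c_s$ for all $s\in\mathcal D(j)$ (if this event has probability $0$, this counts as a decoding failure), and puts out $\hat M_{j,s}=g_s(\hat z_s)$ for $s\in\mathcal D(j)$. Let $\mathrm{Error}(f_{\mathcal S},g_{\mathcal S},c_{\mathcal S})$ be the probability that an encoder declares an error, or that some decoder $j$ fails or has $\hat M_{j,s}\ne M_s$ for some $s\in\mathcal D(j)$. **Hash property.** An ensemble $(\mathcal F,p)$ is a set $\mathcal F$ of functions on a set $\mathcal Z$ with a probability law $p$ on it; $\mathrm{Im}\,\mathcal F$ is the union of the ranges of the $f\in\mathcal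 F$. A sequence of ensembles $(\mathcal F_n,p_n)$ on sets $\mathcal Z_n$ has the hash property if there are $\alpha_n\to1$ and $\beta_n\to0$ such that, for all $n$ and all $z\in\mathcal Z_n$, $\sum_{z'}p_n(\{f:f(z)=f(z')\})\le\beta_n$, where the sum is over the $z'\neq z$ with $p_n(\{f:f(z)=f(z')\})>\alpha_n/|\mathrm{Im}\,\mathcal F_n|$. **Theorem.** Suppose that $R_s\ge0$ for all $s\in\mathcal S$, that $$\sum_{s\in\mathcal S'}(R_s+r_s)<\underline H(\mathbf Z_{\mathcal S'}|\mathbf Z_{\mathring{\mathcal S}(\mathcal I')})\quad\text{for all }\mathcal I'\in\mathfrak I,\ \emptyset\ne\mathcal S'\subset\mathcal S(\mathcal I'),$$ and that $$\sum_{s\in\mathcal D'}r_s>\overline H(\mathbf Z_{\mathcal D'}|\mathbf Y_j,\mathbf Z_{\mathcal D(j)\setminus\mathcal D'})\quad\text{for all }j\in\mathcal J,\ \emptyset\ne\mathcal D'\subset\mathcal D(j).$$ Then for every $\delta>0$ and all sufficiently large $n$ there are functions $f_{\mathcal S},g_{\mathcal S}$ and a vector $c_{\mathcal S}$ with $\mathrm{Error}(f_{\mathcal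 S},g_{\mathcal S},c_{\mathcal S})\le\delta$. Moreover, for any sequences of ensembles $\mathcal F_s$ and $\mathcal G_s$ of functions on $\mathcal Z^n_s$, $s\in\mathcal S$, with $\mathrm{Im}\,\mathcal F_s=\mathcal C^{(n)}_s$ and $\mathrm{Im}\,\mathcal G_s=\mathcal M^{(n)}_s$ that have the hash property (for example, ensembles of sparse matrices with the hash property), for every $\delta>0$ and all sufficiently large $n$ such functions can be chosen with $f_s\in\mathcal F_s$ and $g_s\in\mathcal G_s$ for all $s\in\mathcal S$. -/

import Mathlib

open MeasureTheory ProbabilityTheory Filter Topology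
open scoped ENNReal NNReal

noncomputable section

namespace RelaylessNetwork

/-! ### Message access structures -/

section Access

variable {S I : Type*} [Fintype S] [Fintype I] [DecidableEq S] [DecidableEq I]

/-- The set `I(s)` of the encoders that have access to message `s`. -/
def encodersOf (A : Finset (S × I)) (s : S) : Finset I :=
  Finset.univ.filter fun i => (s, i) ∈ A

/-- The set `S(i)` of the messages to which encoder `i` has access. -/
def messagesOf (A : Finset (S × I)) (i : I) : Finset S :=
  Finset.univ.filter fun s => (s, i) ∈ A

/-- The set `S(I')` of the messages `s` with `I(s) = I'`. -/
def privateMessages (A : Finset (S × I)) (I' : Finset I) : Finset S :=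
  Finset.univ.filter fun s => encodersOf A s = I'

/-- The family `𝔍` of the sets `I'` of encoders with `S(I') ≠ ∅`. -/
def accessFamily (A : Finset (S × I)) : Finset (Finset I) :=
  Finset.univ.filter fun I' => (privateMessages A I').Nonempty

/-- The union `S°(I')` of the sets `S(I'')` over the `I'' ∈ 𝔍` that strictly contain `I'`. -/
def publicMessages (A : Finset (S × I)) (I' : Finset I) : Finset S :=
  ((accessFamily A).filter fun I'' => I' ⊂ I'').biUnion (privateMessages A)

/-- `L` enumerates `𝔍` without repetition, and every set comes after its strict supersets
in `𝔍`. -/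
def IsReverseLinearExtension (A : Finset (S × I)) (L : List (Finset I)) : Prop :=
  L.Nodup ∧ (∀ I', I' ∈ L ↔ I' ∈ accessFamily A) ∧ L.Pairwise fun I₁ I₂ => ¬ I₁ ⊂ I₂

end Access

/-! ### Limits in probability and spectral entropy rates -/

section Spectrum

/-- Limit superior in probability, with values in the extended real line. -/
def pLimsup {Ω : ℕ → Type*} [∀ n, MeasurableSpace (Ω n)] (P : ∀ n, Measure (Ω n))
    (U : ∀ n, Ω n → ℝ) : EReal :=
  sInf {θ : EReal | Tendsto (fun n => P n {ω | θ < (U n ω : EReal)}) atTop (𝓝 0)}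

/-- Limit inferior in probability, with values in the extended real line. -/
def pLiminf {Ω : ℕ → Type*} [∀ n, MeasurableSpace (Ω n)] (P : ∀ n, Measure (Ω n))
    (U : ∀ n, Ω n → ℝ) : EReal :=
  sSup {θ : EReal | Tendsto (fun n => P n {ω | (U n ω : EReal) < θ}) atTop (𝓝 0)}

variable {Ω α β : ℕ → Type*} [∀ n, MeasurableSpace (Ω n)]
  [∀ n, MeasurableSpace (α n)] [∀ n, StandardBorelSpace (α n)] [∀ n, Nonempty (α n)]
  [∀ n, MeasurableSpace (β n)]

/-- The normalized conditional information `(1/n) log₂ (1 / μ_{U|V}(U|V))` of a discrete random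
variable `U n` given `V n`. -/
def condInformation (P : ∀ n, Measure (Ω n)) [∀ n, IsFiniteMeasure (P n)]
    (U : ∀ n, Ω n → α n) (V : ∀ n, Ω n → β n) (n : ℕ) (ω : Ω n) : ℝ :=
  (1 / (n : ℝ)) * Real.logb 2 (1 / (condDistrib (U n) (V n) (P n) (V n ω)).real {U n ω})

/-- The spectral conditional sup-entropy rate of `U` given `V`. -/
def spectralSup (P : ∀ n, Measure (Ω n)) [∀ n, IsFiniteMeasure (P n)]
    (U : ∀ n, Ω n → α n) (V : ∀ n, Ω n → β n) : EReal :=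
  pLimsup P (condInformation P U V)

/-- The spectral conditional inf-entropy rate of `U` given `V`. -/
def spectralInf (P : ∀ n, Measure (Ω n)) [∀ n, IsFiniteMeasure (P n)]
    (U : ∀ n, Ω n → α n) (V : ∀ n, Ω n → β n) : EReal :=
  pLiminf P (condInformation P U V)

end Spectrum

/-! ### The joint law of sources, channel inputs and channel outputs at one block length -/

section Law

variable {S I J : Type*} [Fintype S] [Fintype I] [DecidableEq S] [DecidableEq I]
  {Z : S → Type*} {X : I → Type*} {Y : J → Type*}
  [∀ s, MeasurableSpace (Z s)] [∀ i, MeasurableSpace (X i)] [∀ j, MeasurableSpace (Y j)]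

/-- The conditional probability `μ_{Z_T | Z_T'}(w | z')`; it is `0` if `z'` has probability `0`. -/
def condWeight (μ : Measure (∀ s, Z s)) (T T' : Finset S) (z' : ∀ s : T', Z s)
    (w : ∀ s : T, Z s) : ℝ≥0∞ :=
  μ {z | T.restrict z = w ∧ T'.restrict z = z'} / μ {z | T'.restrict z = z'}

/-- The law `μ` of the discrete source `Z_S` is the product over `I' ∈ 𝔍` of the conditional laws of
`Z_{S(I')}` given `Z_{S°(I')}`. -/
def IsConsistent (A : Finset (S × I)) (μ : Measure (∀ s, Z s)) : Prop :=
  ∀ z : ∀ s, Z s, μ {z} = ∏ I' ∈ accessFamily A,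
    condWeight μ (privateMessages A I') (publicMessages A I')
      ((publicMessages A I').restrict z) ((privateMessages A I').restrict z)

variable [∀ s, Countable (Z s)] [∀ s, MeasurableSingletonClass (Z s)]

/-- The channel from `Z_S` to `X_I`: given `z`, the `X_i` are independent, and `X_i` has the law
`W i` given `z_{S(i)}`. -/
def inputKernel (A : Finset (S × I)) (W : ∀ i, Kernel (∀ s : messagesOf A i, Z s) (X i)) :
    Kernel (∀ s, Z s) (∀ i, X i) :=
  Kernel.ofFunOfCountable fun z => Measure.pi fun i => W i ((messagesOf A i).restrict z)

instance (A : Finset (S × I)) (W : ∀ i, Kernel (∀ s : messagesOf A i, Z s) (X i))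
    [∀ i, IsMarkovKernel (W i)] : IsMarkovKernel (inputKernel A W) :=
  ⟨fun z => inferInstanceAs
    (IsProbabilityMeasure (Measure.pi fun i => W i ((messagesOf A i).restrict z)))⟩

/-- The joint law of `(Z_S, X_I, Y_J)`. -/
def jointLaw (A : Finset (S × I)) (μ : Measure (∀ s, Z s))
    (W : ∀ i, Kernel (∀ s : messagesOf A i, Z s) (X i)) (V : Kernel (∀ i, X i) (∀ j, Y j)) :
    Measure ((∀ s, Z s) × (∀ i, X i) × (∀ j, Y j)) :=
  μ ⊗ₘ (inputKernel A W ⊗ₖ Kernel.prodMkLeft (∀ s, Z s) V)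

instance (A : Finset (S × I)) (μ : Measure (∀ s, Z s)) [IsProbabilityMeasure μ]
    (W : ∀ i, Kernel (∀ s : messagesOf A i, Z s) (X i)) [∀ i, IsMarkovKernel (W i)]
    (V : Kernel (∀ i, X i) (∀ j, Y j)) [IsMarkovKernel V] :
    IsProbabilityMeasure (jointLaw A μ W V) := by
  unfold jointLaw; infer_instance

end Law

/-! ### The code at one block length -/

section Code

/-- Constrained-random-number generator: a random element of `E`, with probabilities proportional
to the weights `w`. If `E` has weight `0`, it declares an error, `none`. -/
def constrainedGenerator {α : Type*} (w : α → ℝ≥0∞) (E : Set α) : PMF (Option α) :=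
  open Classical in
  if h : tsum (E.indicator w) ≠ 0 ∧ tsum (E.indicator w) ≠ ∞ then
    (PMF.normalize (E.indicator w) h.1 h.2).map some
  else PMF.pure none

variable {S I J : Type*} [Fintype S] [Fintype I] [DecidableEq S] [DecidableEq I]
  {Z C M : S → Type*} {X : I → Type*} {Y : J → Type*}

/-- The vectors `z_T` with `f_s(z_s) = c_s` for all `s ∈ T`. -/
def fiber (T : Finset S) (f : ∀ s, Z s → C s) (c : ∀ s : T, C s) : Set (∀ s : T, Z s) :=
  {z | ∀ s : T, f s (z s) = c s}

/-- The vector that agrees with `w` on `T` and with `z` outside `T`. -/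
def overwrite (T : Finset S) (z : ∀ s, Z s) (w : ∀ s : T, Z s) : ∀ s, Z s :=
  fun s => if h : s ∈ T then w ⟨s, h⟩ else z s

variable [∀ s, MeasurableSpace (Z s)]

/-- One encoding step: given the part `z_{S°(I')}` that was generated earlier and the messages
`m_{S(I')}`, generate `z_{S(I')}` according to `μ_{Z_{S(I')} | Z_{S°(I')}}(· | z_{S°(I')})`, subject
to `f_s(z_s) = c_s` and `g_s(z_s) = m_s` for all `s ∈ S(I')`. -/
def encoderGenerator (A : Finset (S × I)) (μ : Measure (∀ s, Z s)) (f : ∀ s, Z s → C s)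
    (g : ∀ s, Z s → M s) (I' : Finset I) (z' : ∀ s : publicMessages A I', Z s)
    (c : ∀ s : privateMessages A I', C s) (m : ∀ s : privateMessages A I', M s) :
    PMF (Option (∀ s : privateMessages A I', Z s)) :=
  constrainedGenerator (condWeight μ (privateMessages A I') (publicMessages A I') z')
    (fiber (privateMessages A I') f c ∩ fiber (privateMessages A I') g m)

/-- The encoding steps along a list of sets of encoders. The output of the step of `I'` is shared by
all encoders in `I'`, so a single vector `z` records all outputs: encoder `i` takes part in the
steps of the `I' ∋ i` only and knows just the part `z_{S(i)}`. The run ends with `none` as soon as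
a step declares an error. -/
def encoderRun (A : Finset (S × I)) (μ : Measure (∀ s, Z s)) (f : ∀ s, Z s → C s)
    (g : ∀ s, Z s → M s) (c : ∀ s, C s) (m : ∀ s, M s) :
    List (Finset I) → (∀ s, Z s) → PMF (Option (∀ s, Z s))
  | [], z => PMF.pure (some z)
  | I' :: L, z =>
    (encoderGenerator A μ f g I' ((publicMessages A I').restrict z)
      ((privateMessages A I').restrict c) ((privateMessages A I').restrict m)).bind fun o =>
        match o with
        | none => PMF.pure none
        | some w => encoderRun A μ f g c m L (overwrite (privateMessages A I') z w)

/-- The output of a decoder for the messages in `D`, with a posteriori law `κ` of `Z_D`, on the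
channel output `y`: generate `ẑ_D` according to `κ(· | y)`, subject to `f_s(ẑ_s) = c_s` for all
`s ∈ D`, and put out `g_s(ẑ_s)`, `s ∈ D`. -/
def decoderOutput {B : Type*} [MeasurableSpace B] (D : Finset S) (κ : Kernel B (∀ s : D, Z s))
    (f : ∀ s, Z s → C s) (g : ∀ s, Z s → M s) (c : ∀ s : D, C s) (y : B) :
    PMF (Option (∀ s : D, M s)) :=
  (constrainedGenerator (fun z => κ y {z}) (fiber D f c)).map
    (Option.map fun z s => g s (z s))

variable [Fintype J]
  [∀ s, Countable (Z s)] [∀ s, MeasurableSingletonClass (Z s)] [∀ s, Nonempty (Z s)]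
  [∀ i, MeasurableSpace (X i)] [∀ j, MeasurableSpace (Y j)]
  [∀ s, Fintype (M s)]

/-- The a posteriori law `μ_{Z_{D(j)} | Y_j}`. -/
def posterior (A : Finset (S × I)) (D : J → Finset S) (μ : Measure (∀ s, Z s))
    [IsProbabilityMeasure μ] (W : ∀ i, Kernel (∀ s : messagesOf A i, Z s) (X i))
    [∀ i, IsMarkovKernel (W i)] (V : Kernel (∀ i, X i) (∀ j, Y j)) [IsMarkovKernel V] (j : J) :
    Kernel (Y j) (∀ s : D j, Z s) :=
  condDistrib (fun ω : (∀ s, Z s) × (∀ i, X i) × (∀ j, Y j) => (D j).restrict ω.1)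
    (fun ω => ω.2.2 j) (jointLaw A μ W V)

/-- The probability that, on the channel outputs `y`, some decoder `j` does not put out `m_s` for
all `s ∈ D(j)`. The decoders use independent randomness. -/
def mismatchProb (A : Finset (S × I)) (D : J → Finset S) (μ : Measure (∀ s, Z s))
    [IsProbabilityMeasure μ] (W : ∀ i, Kernel (∀ s : messagesOf A i, Z s) (X i))
    [∀ i, IsMarkovKernel (W i)] (V : Kernel (∀ i, X i) (∀ j, Y j)) [IsMarkovKernel V]
    (f : ∀ s, Z s → C s) (g : ∀ s, Z s → M s) (c : ∀ s, C s) (m : ∀ s, M s) (y : ∀ j, Y j) :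
    ℝ≥0∞ :=
  open Classical in
  ∑' d : ∀ j, Option (∀ s : D j, M s),
    if ∃ j, d j ≠ some ((D j).restrict m) then
      ∏ j, decoderOutput (D j) (posterior A D μ W V j) f g ((D j).restrict c) (y j) (d j)
    else 0

/-- The total error probability of the code, for independent and uniform messages: the probability
that an encoder declares an error or that some decoder `j` does not reproduce all the messages in
`D(j)`. The starting vector of the encoding run is irrelevant, as every coordinate is generated
before it is used. -/
def errorProb (A : Finset (S × I)) (L : List (Finset I)) (D : J → Finset S)
    (μ : Measure (∀ s, Z s)) [IsProbabilityMeasure μ]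
    (W : ∀ i, Kernel (∀ s : messagesOf A i, Z s) (X i)) [∀ i, IsMarkovKernel (W i)]
    (V : Kernel (∀ i, X i) (∀ j, Y j)) [IsMarkovKernel V]
    (f : ∀ s, Z s → C s) (g : ∀ s, Z s → M s) (c : ∀ s, C s) : ℝ≥0∞ :=
  ∑ m : ∀ s, M s, (∏ s, (Fintype.card (M s) : ℝ≥0∞)⁻¹) *
    ∑' o : Option (∀ s, Z s),
      encoderRun A μ f g c m L (fun _ => Classical.arbitrary _) o *
        match o with
        | none => 1
        | some z => ∫⁻ x, ∫⁻ y, mismatchProb A D μ W V f g c m y ∂(V x) ∂(inputKernel A W z)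

end Code

/-! ### Hash property -/

section Hash

/-- An ensemble of functions: a set of functions with a probability law on it. -/
structure Ensemble (α γ : Type*) [MeasurableSpace γ] where
  /-- The functions of the ensemble. -/
  funs : Set (α → γ)
  /-- The law of the random function. -/
  law : Measure (α → γ)
  isProbabilityMeasure : IsProbabilityMeasure law
  ae_mem : ∀ᵐ f ∂law, f ∈ funs

/-- The union of the ranges of the functions of the ensemble. -/
def Ensemble.im {α γ : Type*} [MeasurableSpace γ] (E : Ensemble α γ) : Set γ :=
  ⋃ f ∈ E.funs, Set.range f

/-- The `(a, b)`-hash property of one ensemble. -/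
def Ensemble.IsHash {α γ : Type*} [MeasurableSpace γ] (E : Ensemble α γ) (a b : ℝ≥0) : Prop :=
  open Classical in
  ∀ z : α, (∑' z' : α,
    if z' ≠ z ∧ (a : ℝ≥0∞) / (E.im.ncard : ℝ≥0∞) < E.law {f | f z = f z'} then
      E.law {f | f z = f z'}
    else 0) ≤ (b : ℝ≥0∞)

/-- The hash property of a sequence of ensembles: the `(a n, b n)`-hash property for some `a → 1`
and `b → 0`. -/
def HasHashProperty {α γ : ℕ → Type*} [∀ n, MeasurableSpace (γ n)]
    (E : ∀ n, Ensemble (α n) (γ n)) : Prop :=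
  ∃ a b : ℕ → ℝ≥0, Tendsto a atTop (𝓝 1) ∧ Tendsto b atTop (𝓝 0) ∧ ∀ n, (E n).IsHash (a n) (b n)

end Hash

end RelaylessNetwork

end

/-! Choose `f_s`, `g_s` and `c_s` at random. A second moment bound over the typical vectors shows
that, below the spectral inf-entropy rates, the value of `(f_s, g_s)_s` at the private messages of
each set of encoders is nearly uniform given the public ones. Prescribing a uniform value and
sampling from its fiber therefore reproduces the conditional law of the source up to a small mean
loss, and as the law of the source factorizes along the access structure, the losses of the
successive encoding steps add up. The decoder may thus be analysed under the true law of the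
source. There the decoded vector and the source vector are an exchangeable pair given the output
and the values `f_s`: both are typical with high probability, and above the spectral sup-entropy
rates two different typical vectors rarely have the same values. Averaging over all choices gives
functions in the given ensembles, and random binning, the ensemble of all functions, has the hash
property. -/

noncomputable section

namespace RelaylessNetwork

/-! ### Masses of fibers -/

section FiberMass

variable {α Γ : Type*}

/-- The total weight of the fiber of `φ` over `a`, that is, the image under `φ` of the discrete
measure with weights `q`. -/
def fiberMass (q : α → ℝ≥0∞) (φ : α → Γ) (a : Γ) : ℝ≥0∞ :=
  ∑' x, (φ ⁻¹' {a}).indicator q x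

theorem le_fiberMass (q : α → ℝ≥0∞) (φ : α → Γ) (x : α) : q x ≤ fiberMass q φ (φ x) :=
  (Set.indicator_of_mem (s := φ ⁻¹' {φ x}) rfl q).ge.trans (ENNReal.le_tsum x)

theorem fiberMass_le_tsum (q : α → ℝ≥0∞) (φ : α → Γ) (a : Γ) : fiberMass q φ a ≤ ∑' x, q x :=
  ENNReal.tsum_le_tsum fun _ => Set.indicator_le_self _ _ _

theorem fiberMass_mono {q q' : α → ℝ≥0∞} (h : q ≤ q') (φ : α → Γ) (a : Γ) :
    fiberMass q φ a ≤ fiberMass q' φ a :=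
  ENNReal.tsum_le_tsum fun _ => Set.indicator_le_indicator (h _)

theorem fiberMass_indicator_add_compl (q : α → ℝ≥0∞) (T : Set α) (φ : α → Γ) (a : Γ) :
    fiberMass (T.indicator q) φ a + fiberMass (Tᶜ.indicator q) φ a = fiberMass q φ a := by
  simp only [fiberMass, ← ENNReal.tsum_add, ← Set.indicator_add, Set.indicator_self_add_compl_apply]

theorem fiberMass_indicator_le {q : α → ℝ≥0∞} {T : Set α} {φ : α → Γ} {B : ℝ≥0∞}
    (hB : ∀ x ∈ T, fiberMass q φ (φ x) ≤ B) (a : Γ) : fiberMass (T.indicator q) φ a ≤ B := by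
  by_cases h : ∃ x ∈ T, φ x = a
  · obtain ⟨x, hx, rfl⟩ := h
    exact (fiberMass_mono (Set.indicator_le_self T q) φ _).trans (hB x hx)
  · refine (ENNReal.tsum_eq_zero.2 fun x => ?_).trans_le zero_le
    refine Set.indicator_apply_eq_zero.2 fun hx => Set.indicator_of_notMem (fun hT => h ?_) _
    exact ⟨x, hT, hx⟩

theorem tsum_mul_comp_eq_tsum_fiberMass (q : α → ℝ≥0∞) (φ : α → Γ) (ψ : Γ → ℝ≥0∞) :
    ∑' x, q x * ψ (φ x) = ∑' a, fiberMass q φ a * ψ a := by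
  simp only [fiberMass, ← ENNReal.tsum_mul_right]
  rw [ENNReal.tsum_comm]
  refine tsum_congr fun x => ?_
  rw [tsum_eq_single (φ x), Set.indicator_of_mem (s := φ ⁻¹' {φ x}) rfl]
  intro a ha
  rw [Set.indicator_of_notMem (s := φ ⁻¹' {a}) ha.symm, zero_mul]

theorem tsum_fiberMass (q : α → ℝ≥0∞) (φ : α → Γ) : ∑' a, fiberMass q φ a = ∑' x, q x := by
  simpa using (tsum_mul_comp_eq_tsum_fiberMass q φ fun _ => 1).symm

end FiberMass

/-! ### Collision sums over product spaces -/

section Collision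

variable {ι : Type*} {Z : ι → Type*}

theorem tsum_pi_prod_le [Fintype ι] (p : ∀ i, Z i → ℝ≥0∞) :
    ∑' w : ∀ i, Z i, ∏ i, p i (w i) ≤ ∏ i, ∑' x, p i x := by
  classical
  rw [ENNReal.tsum_eq_iSup_sum]
  refine iSup_le fun F => ?_
  calc ∑ w ∈ F, ∏ i, p i (w i)
      ≤ ∑ w ∈ Fintype.piFinset fun i => F.image fun w => w i, ∏ i, p i (w i) :=
        Finset.sum_le_sum_of_subset fun w hw =>
          Fintype.mem_piFinset.2 fun i => Finset.mem_image_of_mem _ hw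
    _ = ∏ i, ∑ x ∈ F.image fun w => w i, p i x := (Finset.prod_univ_sum _ _).symm
    _ ≤ ∏ i, ∑' x, p i x := Finset.prod_le_prod' fun i _ => ENNReal.sum_le_tsum _

theorem tsum_indicator_mul_prod_le (q : (∀ i, Z i) → ℝ≥0∞) (T : Set (∀ i, Z i))
    (p : ∀ i, Z i → ℝ≥0∞) (O : Finset ι) {B : ℝ≥0∞}
    (hB : ∀ w ∈ T, fiberMass q O.restrict (O.restrict w) ≤ B) :
    ∑' w, T.indicator q w * ∏ i ∈ O, p i (w i) ≤ (∏ i ∈ O, ∑' x, p i x) * B := by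
  calc ∑' w, T.indicator q w * ∏ i ∈ O, p i (w i)
      = ∑' w, T.indicator q w * ∏ i : O, p i (O.restrict w i) :=
        tsum_congr fun w => by rw [← Finset.prod_coe_sort O]; rfl
    _ = ∑' u : ∀ i : O, Z i, fiberMass (T.indicator q) O.restrict u * ∏ i : O, p i (u i) :=
        tsum_mul_comp_eq_tsum_fiberMass (Γ := ∀ i : O, Z i) _ _ fun u => ∏ i : O, p i (u i)
    _ ≤ ∑' u : ∀ i : O, Z i, B * ∏ i : O, p i (u i) :=
        ENNReal.tsum_le_tsum fun u => mul_le_mul' (fiberMass_indicator_le hB u) le_rfl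
    _ ≤ (∏ i ∈ O, ∑' x, p i x) * B := by
        rw [ENNReal.tsum_mul_left, mul_comm, ← Finset.prod_coe_sort O]
        exact mul_le_mul' (tsum_pi_prod_le fun (i : O) => p i) le_rfl

variable [Fintype ι]

/-- Vectors are sorted by the set `O` of the coordinates at which they lie in `E`. -/
theorem tsum_indicator_mul_prod_le_sum [DecidableEq ι] (q : (∀ i, Z i) → ℝ≥0∞) (T : Set (∀ i, Z i))
    (p : ∀ i, Z i → ℝ≥0∞) (E : ∀ i, Set (Z i)) (a b : ι → ℝ≥0∞) (B : Finset ι → ℝ≥0∞)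
    (ha : ∀ i, ∀ x ∉ E i, p i x ≤ a i) (hb : ∀ i, ∑' x, (E i).indicator (p i) x ≤ b i)
    (hB : ∀ O, ∀ w ∈ T, fiberMass q O.restrict (O.restrict w) ≤ B O) :
    ∑' w, T.indicator q w * ∏ i, p i (w i) ≤
      ∑ O : Finset ι, (∏ i ∈ Oᶜ, a i) * ((∏ i ∈ O, b i) * B O) := by
  classical
  have hprod : ∀ w : ∀ i, Z i, ∏ i, p i (w i) ≤
      ∑ O : Finset ι, (∏ i ∈ Oᶜ, a i) * ∏ i ∈ O, (E i).indicator (p i) (w i) := fun w => by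
    obtain ⟨O, hO⟩ : ∃ O : Finset ι, ∀ i, i ∈ O ↔ w i ∈ E i :=
      ⟨Finset.univ.filter fun i => w i ∈ E i, by simp⟩
    refine le_trans ?_ (Finset.single_le_sum (fun O _ => zero_le) (Finset.mem_univ O))
    rw [← Finset.prod_compl_mul_prod O]
    exact mul_le_mul'
      (Finset.prod_le_prod' fun i hi => ha i _ (mt (hO i).2 (Finset.mem_compl.1 hi)))
      (Finset.prod_le_prod' fun i hi => (Set.indicator_of_mem ((hO i).1 hi) _).ge)
  calc ∑' w, T.indicator q w * ∏ i, p i (w i)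
      ≤ ∑' w, ∑ O : Finset ι, (∏ i ∈ Oᶜ, a i) *
          (T.indicator q w * ∏ i ∈ O, (E i).indicator (p i) (w i)) := by
        refine ENNReal.tsum_le_tsum fun w => (mul_le_mul' le_rfl (hprod w)).trans_eq ?_
        simp only [Finset.mul_sum, mul_left_comm]
    _ = ∑ O : Finset ι, (∏ i ∈ Oᶜ, a i) *
          ∑' w, (T.indicator q w * ∏ i ∈ O, (E i).indicator (p i) (w i)) := by
        simp_rw [Summable.tsum_finsetSum fun _ _ => ENNReal.summable, ENNReal.tsum_mul_left]
    _ ≤ ∑ O : Finset ι, (∏ i ∈ Oᶜ, a i) * ((∏ i ∈ O, b i) * B O) := by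
        refine Finset.sum_le_sum fun O _ => mul_le_mul' le_rfl ?_
        exact (tsum_indicator_mul_prod_le q T _ O (hB O)).trans
          (mul_le_mul' (Finset.prod_le_prod' fun i _ => hb i) le_rfl)

/-- Vectors are sorted by the set `O` of the coordinates at which they differ from `z`. -/
theorem tsum_indicator_ne_prod_le_sum (z : ∀ i, Z i) (T : Set (∀ i, Z i)) (p : ∀ i, Z i → ℝ≥0∞)
    (E : ∀ i, Set (Z i)) (a : ι → ℝ≥0∞) (N : Finset ι → ℝ≥0∞)
    (hp : ∀ i x, p i x ≤ 1) (ha : ∀ i, ∀ x ∉ E i, x ≠ z i → p i x ≤ a i)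
    (hN : ∀ O : Finset ι, O.Nonempty → ({w ∈ T | ∀ i ∉ O, w i = z i}.encard : ℝ≥0∞) ≤ N O) :
    ∑' w, {w | w ∈ T ∧ w ≠ z ∧ ∀ i, w i ∉ E i}.indicator (fun w => ∏ i, p i (w i)) w ≤
      ∑ O : Finset ι with O.Nonempty, N O * ∏ i ∈ O, a i := by
  classical
  have hprod : ∀ w ∈ {w | w ∈ T ∧ w ≠ z ∧ ∀ i, w i ∉ E i}, ∏ i, p i (w i) ≤
      ∑ O : Finset ι with O.Nonempty, {w ∈ T | ∀ i ∉ O, w i = z i}.indicator 1 w *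
        ∏ i ∈ O, a i := by
    rintro w ⟨hwT, hne, hwE⟩
    obtain ⟨O, hO⟩ : ∃ O : Finset ι, ∀ i, i ∈ O ↔ w i ≠ z i :=
      ⟨Finset.univ.filter fun i => w i ≠ z i, by simp⟩
    have hOne : O.Nonempty := (Function.ne_iff.1 hne).imp fun i => (hO i).2
    have hw : w ∈ {w ∈ T | ∀ i ∉ O, w i = z i} := ⟨hwT, fun i hi => not_not.1 (mt (hO i).2 hi)⟩
    calc ∏ i, p i (w i)
        = (∏ i ∈ Oᶜ, p i (w i)) * ∏ i ∈ O, p i (w i) := (Finset.prod_compl_mul_prod O _).symm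
      _ ≤ 1 * ∏ i ∈ O, a i := mul_le_mul' (Finset.prod_le_one' fun i _ => hp i _)
          (Finset.prod_le_prod' fun i hi => ha i _ (hwE i) ((hO i).1 hi))
      _ = {w ∈ T | ∀ i ∉ O, w i = z i}.indicator 1 w * ∏ i ∈ O, a i := by
          rw [Set.indicator_of_mem hw, Pi.one_apply]
      _ ≤ _ := Finset.single_le_sum (f := fun O => {w ∈ T | ∀ i ∉ O, w i = z i}.indicator 1 w *
          ∏ i ∈ O, a i) (fun O _ => zero_le) (Finset.mem_filter.2 ⟨Finset.mem_univ O, hOne⟩)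
  calc ∑' w, {w | w ∈ T ∧ w ≠ z ∧ ∀ i, w i ∉ E i}.indicator (fun w => ∏ i, p i (w i)) w
      ≤ ∑' w, ∑ O : Finset ι with O.Nonempty, {w ∈ T | ∀ i ∉ O, w i = z i}.indicator 1 w *
          ∏ i ∈ O, a i :=
        ENNReal.tsum_le_tsum fun w => Set.indicator_apply_le' (hprod w) fun _ => zero_le
    _ = ∑ O : Finset ι with O.Nonempty, ({w ∈ T | ∀ i ∉ O, w i = z i}.encard : ℝ≥0∞) *
          ∏ i ∈ O, a i := by
        simp_rw [Summable.tsum_finsetSum fun _ _ => ENNReal.summable, ENNReal.tsum_mul_right,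
          ← ENNReal.tsum_set_one, tsum_subtype _ fun _ => (1 : ℝ≥0∞)]
        rfl
    _ ≤ ∑ O : Finset ι with O.Nonempty, N O * ∏ i ∈ O, a i :=
        Finset.sum_le_sum fun O hO => mul_le_mul' (hN O (Finset.mem_filter.1 hO).2) le_rfl

end Collision

/-! ### Resampling from a fiber -/

section Resample

variable {α Γ : Type*}

/-- The joint law of an element `x` of weights `q` and of an element `x'` drawn with the same
weights from the fiber of `φ` through `x`. -/
def resample (q : α → ℝ≥0∞) (φ : α → Γ) (x x' : α) : ℝ≥0∞ :=
  q x * ((φ ⁻¹' {φ x}).indicator q x' / fiberMass q φ (φ x))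

theorem resample_comm (q : α → ℝ≥0∞) (φ : α → Γ) (x x' : α) :
    resample q φ x x' = resample q φ x' x := by
  by_cases h : φ x = φ x'
  · simp only [resample, h, Set.indicator_of_mem (s := φ ⁻¹' {φ x'}) h,
      Set.indicator_of_mem (s := φ ⁻¹' {φ x'}) (a := x') rfl, div_eq_mul_inv]
    exact mul_left_comm _ _ _
  · simp only [resample, Set.indicator_of_notMem (s := φ ⁻¹' {φ x'}) h,
      Set.indicator_of_notMem (s := φ ⁻¹' {φ x}) (a := x') (Ne.symm h), ENNReal.zero_div, mul_zero]

theorem tsum_resample_le (q : α → ℝ≥0∞) (φ : α → Γ) (x : α) : ∑' x', resample q φ x x' ≤ q x := by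
  simp_rw [resample, ENNReal.tsum_mul_left, div_eq_mul_inv, ENNReal.tsum_mul_right]
  exact mul_le_of_le_one_right' ENNReal.div_self_le_one

/-- The probability that an element drawn with weights `q` from the fiber of `φ` through `x` differs
from `x`. -/
def missProb (q : α → ℝ≥0∞) (φ : α → Γ) (x : α) : ℝ≥0∞ :=
  1 - q x / fiberMass q φ (φ x)

theorem mul_missProb_le (q : α → ℝ≥0∞) (hq : ∑' x, q x ≠ ∞) (φ : α → Γ) (x : α) :
    q x * missProb q φ x ≤ ∑' x', ({x}ᶜ : Set α).indicator (resample q φ x) x' := by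
  classical
  by_cases h0 : q x = 0
  · simp [h0]
  have hm : fiberMass q φ (φ x) ≠ 0 := fun h => h0 (le_zero_iff.1 (h ▸ le_fiberMass q φ x))
  have hm' : fiberMass q φ (φ x) ≠ ∞ := ne_top_of_le_ne_top hq (fiberMass_le_tsum q φ _)
  have hqx : q x ≠ ∞ := ENNReal.ne_top_of_tsum_ne_top hq x
  have htotal : ∑' x', resample q φ x x' = q x := by
    simp_rw [resample, ENNReal.tsum_mul_left, div_eq_mul_inv, ENNReal.tsum_mul_right]
    rw [← fiberMass, ENNReal.mul_inv_cancel hm hm', mul_one]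
  have hself : ∑' x', ({x} : Set α).indicator (resample q φ x) x' =
      q x * (q x / fiberMass q φ (φ x)) := by
    rw [tsum_eq_single x fun y hy => Set.indicator_of_notMem (s := {x}) hy _,
      Set.indicator_of_mem (s := {x}) rfl, resample, Set.indicator_of_mem (s := φ ⁻¹' {φ x}) rfl]
  rw [missProb, ENNReal.mul_sub fun _ _ => hqx, mul_one, tsub_le_iff_left, ← hself,
    ← ENNReal.tsum_add]
  simp_rw [Set.indicator_self_add_compl_apply]
  exact htotal.ge

/-- As the two elements of a resampled pair are exchangeable, the second one leaves `T` as rarely as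
the first. -/
theorem tsum_mul_missProb_le (q : α → ℝ≥0∞) (hq : ∑' x, q x ≠ ∞) (φ : α → Γ)
    (T : Set α) (b : α → ℝ≥0∞) (hb : ∀ x ∈ T, (∃ x' ∈ T, x' ≠ x ∧ φ x' = φ x) → 1 ≤ b x) :
    ∑' x, q x * missProb q φ x ≤
      2 * ∑' x, Tᶜ.indicator q x + ∑' x, q x * b x := by
  classical
  let out (x x' : α) : ℝ≥0∞ := Tᶜ.indicator (fun x => resample q φ x x') x
  have hpair : ∀ x x', ({x}ᶜ : Set α).indicator (resample q φ x) x' ≤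
      out x x' + out x' x + resample q φ x x' * b x := fun x x' => by
    by_cases hne : x' = x
    · simp [hne]
    rw [Set.indicator_of_mem (s := {x}ᶜ) hne]
    by_cases hx : x ∈ T
    swap
    · exact (Set.indicator_of_mem (s := Tᶜ) hx fun x => resample q φ x x').ge.trans
        (le_self_add.trans le_self_add)
    by_cases hx' : x' ∈ T
    swap
    · rw [resample_comm]
      exact (Set.indicator_of_mem (s := Tᶜ) hx' fun x' => resample q φ x' x).ge.trans
        (le_add_self.trans le_self_add)
    refine le_add_left ?_
    by_cases hφ : φ x' = φ x
    · exact le_mul_of_one_le_right' (hb x hx ⟨x', hx', hne, hφ⟩)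
    · rw [resample, Set.indicator_of_notMem (s := φ ⁻¹' {φ x}) hφ]
      simp
  have hout : ∑' x, ∑' x', out x x' ≤ ∑' x, Tᶜ.indicator q x := ENNReal.tsum_le_tsum fun x => by
    by_cases hx : x ∈ Tᶜ
    · simpa only [out, Set.indicator_of_mem hx] using tsum_resample_le q φ x
    · simp only [out, Set.indicator_of_notMem hx, tsum_zero, le_refl]
  calc ∑' x, q x * missProb q φ x
      ≤ ∑' x, ∑' x', (out x x' + out x' x + resample q φ x x' * b x) :=
        ENNReal.tsum_le_tsum fun x => (mul_missProb_le q hq φ x).trans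
          (ENNReal.tsum_le_tsum (hpair x))
    _ = (∑' x, ∑' x', out x x' + ∑' x, ∑' x', out x x') +
          ∑' x, (∑' x', resample q φ x x') * b x := by
        simp_rw [ENNReal.tsum_add, ENNReal.tsum_mul_right]
        rw [ENNReal.tsum_comm (f := fun x x' => out x' x)]
    _ ≤ 2 * ∑' x, Tᶜ.indicator q x + ∑' x, q x * b x := by
        rw [two_mul]
        exact add_le_add (add_le_add hout hout)
          (ENNReal.tsum_le_tsum fun x => mul_le_mul' (tsum_resample_le q φ x) le_rfl)

end Resample

/-! ### Near uniformity of the values of a random function -/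

section Uniformity

variable {α Γ : Type*}

/-- With `x = N t - 1` this is `4 η x ≤ 4 η² + x²`, divided by `N`. -/
theorem four_mul_tsub_add_two_mul_le {η t N : ℝ≥0∞} (hη : η ≠ ∞) (ht : t ≠ ∞) (hN : N ≠ ∞)
    (hN0 : N ≠ 0) :
    4 * η * (t - N⁻¹) + 2 * t ≤ 4 * η ^ 2 * N⁻¹ + N * (t * t) + N⁻¹ := by
  lift η to ℝ≥0 using hη
  lift t to ℝ≥0 using ht
  lift N to ℝ≥0 using hN
  have hN0' : N ≠ 0 := by simpa using hN0
  rw [← ENNReal.coe_inv hN0', ← ENNReal.coe_sub]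
  norm_cast
  rw [← NNReal.coe_le_coe]
  push_cast [NNReal.sub_def, Real.coe_toNNReal']
  have _ : (0 : ℝ) < N := by positivity
  rcases max_choice ((t : ℝ) - (N : ℝ)⁻¹) 0 with h | h <;> rw [h, ← sub_nonneg]
  · have : 0 ≤ ((N : ℝ) * t - 1 - 2 * η) ^ 2 / N := by positivity
    convert this using 1
    field_simp
    ring
  · have : 0 ≤ (((N : ℝ) * t - 1) ^ 2 + 4 * (η : ℝ) ^ 2) / N := by positivity
    convert this using 1
    field_simp
    ring

/-- The ratio, truncated at `1`, between the uniform probability of `φ x` and the total weight of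
the fiber of `φ` through `x`. It compares an element drawn from the fiber of `φ` over a uniform
value with an element of weights `q`. -/
def fiberDensity [Fintype Γ] (q : α → ℝ≥0∞) (φ : α → Γ) (x : α) : ℝ≥0∞ :=
  min 1 ((Fintype.card Γ : ℝ≥0∞)⁻¹ / fiberMass q φ (φ x))

theorem mul_one_sub_min_div_le {s u : ℝ≥0∞} (hs : s ≠ ∞) : s * (1 - min 1 (u / s)) ≤ s - u := by
  by_cases h0 : s = 0
  · simp [h0]
  rw [ENNReal.mul_sub fun _ _ => hs, mul_one, mul_min, mul_one, ENNReal.mul_div_cancel h0 hs]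
  rcases le_total s u with h | h <;> simp [h]

theorem tsum_mul_one_sub_fiberDensity_le [Fintype Γ] (q : α → ℝ≥0∞) (hq : ∑' x, q x ≠ ∞)
    (φ : α → Γ) (T : Set α) :
    ∑' x, q x * (1 - fiberDensity q φ x) ≤
      ∑ a, (fiberMass (T.indicator q) φ a - (Fintype.card Γ : ℝ≥0∞)⁻¹) +
        ∑' x, Tᶜ.indicator q x := by
  set u : ℝ≥0∞ := (Fintype.card Γ : ℝ≥0∞)⁻¹
  refine (tsum_mul_comp_eq_tsum_fiberMass q φ fun a => 1 - min 1 (u / fiberMass q φ a)).trans_le ?_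
  rw [← tsum_fiberMass _ φ, tsum_fintype, tsum_fintype, ← Finset.sum_add_distrib]
  refine Finset.sum_le_sum fun a _ => ?_
  calc fiberMass q φ a * (1 - min 1 (u / fiberMass q φ a))
      ≤ fiberMass q φ a - u :=
        mul_one_sub_min_div_le (ne_top_of_le_ne_top hq (fiberMass_le_tsum q φ a))
    _ ≤ (fiberMass (T.indicator q) φ a - u) + fiberMass (Tᶜ.indicator q) φ a := by
        rw [← fiberMass_indicator_add_compl q T φ a, tsub_le_iff_left, ← add_assoc]
        exact add_le_add le_add_tsub le_rfl

/-- The free parameter `η` keeps the bound linear in the second moment, so that it can be averaged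
over a random `φ`. -/
theorem four_mul_tsum_mul_one_sub_fiberDensity_le [Fintype Γ] [Nonempty Γ] (q : α → ℝ≥0∞)
    (hq : ∑' x, q x = 1) (φ : α → Γ) (T : Set α) {η : ℝ≥0∞} (hη : η ≠ ∞) :
    4 * η * ∑' x, q x * (1 - fiberDensity q φ x) + 2 ≤
      4 * η ^ 2 + 1 + (Fintype.card Γ : ℝ≥0∞) *
          ∑' x, T.indicator q x * fiberMass (T.indicator q) φ (φ x) +
        (2 + 4 * η) * ∑' x, Tᶜ.indicator q x := by
  classical
  set N : ℝ≥0∞ := (Fintype.card Γ : ℝ≥0∞) with hN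
  have hNtop : N ≠ ∞ := ENNReal.natCast_ne_top _
  have hN0 : N ≠ 0 := by simp [hN]
  have hqtop : ∑' x, q x ≠ ∞ := hq ▸ ENNReal.one_ne_top
  set t : Γ → ℝ≥0∞ := fiberMass (T.indicator q) φ
  have htop : ∀ a, t a ≠ ∞ := fun a => ne_top_of_le_ne_top hqtop
    ((fiberMass_mono (Set.indicator_le_self T q) φ a).trans (fiberMass_le_tsum q φ a))
  have huniform : ∑ _a : Γ, N⁻¹ = 1 := by
    rw [Finset.sum_const, Finset.card_univ, nsmul_eq_mul, ENNReal.mul_inv_cancel hN0 hNtop]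
  have htotal : ∑ a, t a + ∑' x, Tᶜ.indicator q x = 1 := by
    rw [← tsum_fintype (L := .unconditional Γ) t, tsum_fiberMass, ← ENNReal.tsum_add, ← hq]
    simp_rw [Set.indicator_self_add_compl_apply]
  have hsquare : ∑' x, T.indicator q x * t (φ x) = ∑ a, t a * t a := by
    rw [tsum_mul_comp_eq_tsum_fiberMass, tsum_fintype]
  calc 4 * η * ∑' x, q x * (1 - fiberDensity q φ x) + 2
      ≤ 4 * η * (∑ a, (t a - N⁻¹) + ∑' x, Tᶜ.indicator q x) +
          2 * (∑ a, t a + ∑' x, Tᶜ.indicator q x) := by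
        rw [htotal, mul_one]
        gcongr
        exact tsum_mul_one_sub_fiberDensity_le q hqtop φ T
    _ = ∑ a, (4 * η * (t a - N⁻¹) + 2 * t a) + (2 + 4 * η) * ∑' x, Tᶜ.indicator q x := by
        rw [Finset.sum_add_distrib, ← Finset.mul_sum, ← Finset.mul_sum]
        ring
    _ ≤ ∑ a, (4 * η ^ 2 * N⁻¹ + N * (t a * t a) + N⁻¹) +
          (2 + 4 * η) * ∑' x, Tᶜ.indicator q x :=
        add_le_add (Finset.sum_le_sum fun a _ =>
          four_mul_tsub_add_two_mul_le hη (htop a) hNtop hN0) le_rfl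
    _ = _ := by
        rw [Finset.sum_add_distrib, Finset.sum_add_distrib, ← Finset.mul_sum, ← Finset.mul_sum,
          huniform, hsquare]
        ring

end Uniformity

/-! ### Random hash functions -/

section RandomFunction

variable {H α Γ : Type*} [MeasurableSpace H] [Countable α]

theorem measurable_fiberMass {q : H → α → ℝ≥0∞} {Φ : H → α → Γ}
    (hq : ∀ x, Measurable fun h => q h x) (hΦ : ∀ x x', MeasurableSet {h | Φ h x' = Φ h x})
    (x : α) : Measurable fun h => fiberMass (q h) (Φ h) (Φ h x) :=
  Measurable.tsum fun x' => (hq x').indicator (hΦ x x')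

theorem measurable_missProb {q : H → α → ℝ≥0∞} {Φ : H → α → Γ}
    (hq : ∀ x, Measurable fun h => q h x) (hΦ : ∀ x x', MeasurableSet {h | Φ h x' = Φ h x})
    (x : α) : Measurable fun h => missProb (q h) (Φ h) x :=
  ((hq x).div (measurable_fiberMass hq hΦ x)).const_sub 1

theorem measurable_fiberDensity [Fintype Γ] {q : H → α → ℝ≥0∞} {Φ : H → α → Γ}
    (hq : ∀ x, Measurable fun h => q h x) (hΦ : ∀ x x', MeasurableSet {h | Φ h x' = Φ h x})
    (x : α) : Measurable fun h => fiberDensity (q h) (Φ h) x :=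
  measurable_const.min (measurable_const.div (measurable_fiberMass hq hΦ x))

variable (ν : Measure H) {q : α → ℝ≥0∞} {Φ : H → α → Γ}
  (hΦ : ∀ x x', MeasurableSet {h | Φ h x' = Φ h x})

include hΦ

theorem lintegral_tsum_mul_fiberMass :
    ∫⁻ h, ∑' x, q x * fiberMass q (Φ h) (Φ h x) ∂ν =
      ∑' x, q x * ∑' x', q x' * ν {h | Φ h x' = Φ h x} := by
  have hmeas := measurable_fiberMass (q := fun _ => q) (fun _ => measurable_const) hΦ
  rw [lintegral_tsum fun x => ((hmeas x).const_mul _).aemeasurable]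
  refine tsum_congr fun x => ?_
  rw [lintegral_const_mul _ (hmeas x)]
  congr 1
  refine (lintegral_tsum fun x' => (measurable_const.indicator (hΦ x x')).aemeasurable).trans ?_
  exact tsum_congr fun x' => lintegral_indicator_const (hΦ x x') _

variable [IsProbabilityMeasure ν]

theorem lintegral_tsum_mul_missProb_le (hq : ∑' x, q x = 1) (T : Set α) {b : ℝ≥0∞}
    (hb : ∀ x ∈ T, ν {h | ∃ x' ∈ T, x' ≠ x ∧ Φ h x' = Φ h x} ≤ b) :
    ∫⁻ h, ∑' x, q x * missProb q (Φ h) x ∂ν ≤ 2 * ∑' x, Tᶜ.indicator q x + b := by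
  let coll (x : α) : Set H := {h | x ∈ T ∧ ∃ x' ∈ T, x' ≠ x ∧ Φ h x' = Φ h x}
  have hcoll : ∀ x, MeasurableSet (coll x) := fun x => by
    have : coll x = ⋃ x', {_h | x ∈ T ∧ x' ∈ T ∧ x' ≠ x} ∩ {h | Φ h x' = Φ h x} := by
      ext
      simp [coll, and_assoc]
    rw [this]
    exact MeasurableSet.iUnion fun x' => (MeasurableSet.const _).inter (hΦ x x')
  have hcoll_le : ∀ x, ν (coll x) ≤ b := fun x => by
    by_cases hx : x ∈ T
    · exact (measure_mono fun _ hh => hh.2).trans (hb x hx)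
    · simp [coll, hx]
  have hmeas : ∀ x, Measurable ((coll x).indicator (1 : H → ℝ≥0∞)) := fun x =>
    measurable_one.indicator (hcoll x)
  calc ∫⁻ h, ∑' x, q x * missProb q (Φ h) x ∂ν
      ≤ ∫⁻ h, (2 * ∑' x, Tᶜ.indicator q x + ∑' x, q x * (coll x).indicator 1 h) ∂ν :=
        lintegral_mono fun h => tsum_mul_missProb_le q (hq ▸ ENNReal.one_ne_top) (Φ h) T _
          fun x hx hx' => (Set.indicator_of_mem (s := coll x) ⟨hx, hx'⟩ 1).ge
    _ = 2 * ∑' x, Tᶜ.indicator q x + ∑' x, q x * ν (coll x) := by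
        rw [lintegral_add_left measurable_const, lintegral_const, measure_univ, mul_one,
          lintegral_tsum fun x => ((hmeas x).const_mul _).aemeasurable]
        simp_rw [lintegral_const_mul _ (hmeas _), lintegral_indicator_one (hcoll _)]
    _ ≤ 2 * ∑' x, Tᶜ.indicator q x + b := by
        rw [← one_mul b, ← hq, ← ENNReal.tsum_mul_right]
        exact add_le_add le_rfl (ENNReal.tsum_le_tsum fun x => mul_le_mul' le_rfl (hcoll_le x))

theorem four_mul_lintegral_tsum_mul_one_sub_fiberDensity_le [Fintype Γ] [Nonempty Γ]
    (hq : ∑' x, q x = 1) (T : Set α) {η : ℝ≥0∞} (hη : η ≠ ∞) {K : ℝ≥0∞}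
    (hK : ∀ x, ∑' x', T.indicator q x' * ν {h | Φ h x' = Φ h x} ≤ K) :
    4 * η * ∫⁻ h, ∑' x, q x * (1 - fiberDensity q (Φ h) x) ∂ν + 2 ≤
      4 * η ^ 2 + 1 + (Fintype.card Γ : ℝ≥0∞) * K + (2 + 4 * η) * ∑' x, Tᶜ.indicator q x := by
  have hdensity : Measurable fun h => ∑' x, q x * (1 - fiberDensity q (Φ h) x) :=
    Measurable.tsum fun x => ((measurable_fiberDensity (q := fun _ => q)
      (fun _ => measurable_const) hΦ x).const_sub 1).const_mul _
  have hmass : Measurable fun h =>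
      ∑' x, T.indicator q x * fiberMass (T.indicator q) (Φ h) (Φ h x) :=
    Measurable.tsum fun x => (measurable_fiberMass (q := fun _ => T.indicator q)
      (fun _ => measurable_const) hΦ x).const_mul _
  calc 4 * η * ∫⁻ h, ∑' x, q x * (1 - fiberDensity q (Φ h) x) ∂ν + 2
      = ∫⁻ h, (4 * η * ∑' x, q x * (1 - fiberDensity q (Φ h) x) + 2) ∂ν := by
        rw [lintegral_add_right _ measurable_const, lintegral_const_mul _ hdensity, lintegral_const,
          measure_univ, mul_one]
    _ ≤ ∫⁻ h, (4 * η ^ 2 + 1 + (Fintype.card Γ : ℝ≥0∞) *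
            ∑' x, T.indicator q x * fiberMass (T.indicator q) (Φ h) (Φ h x) +
          (2 + 4 * η) * ∑' x, Tᶜ.indicator q x) ∂ν :=
        lintegral_mono fun h => four_mul_tsum_mul_one_sub_fiberDensity_le q hq (Φ h) T hη
    _ = 4 * η ^ 2 + 1 + (Fintype.card Γ : ℝ≥0∞) * (∑' x, T.indicator q x *
            ∑' x', T.indicator q x' * ν {h | Φ h x' = Φ h x}) +
          (2 + 4 * η) * ∑' x, Tᶜ.indicator q x := by
        rw [lintegral_add_right _ measurable_const, lintegral_add_left measurable_const,
          lintegral_const_mul _ hmass, lintegral_tsum_mul_fiberMass ν hΦ]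
        simp only [lintegral_const, measure_univ, mul_one]
    _ ≤ 4 * η ^ 2 + 1 + (Fintype.card Γ : ℝ≥0∞) * K + (2 + 4 * η) * ∑' x, Tᶜ.indicator q x := by
        gcongr
        calc ∑' x, T.indicator q x * ∑' x', T.indicator q x' * ν {h | Φ h x' = Φ h x}
            ≤ ∑' x, q x * K := ENNReal.tsum_le_tsum fun x =>
              mul_le_mul' (Set.indicator_le_self _ _ _) (hK x)
          _ = K := by rw [ENNReal.tsum_mul_right, hq, one_mul]

end RandomFunction

/-- The optimal choice is `η = (d - ε) / 2`. -/
theorem le_add_rpow_of_forall_four_mul_le {d ε κ : ℝ≥0∞} (hd : d ≠ ∞)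
    (h : ∀ η : ℝ≥0∞, η ≠ ∞ → 4 * η * d + 2 ≤ 4 * η ^ 2 + 1 + κ + (2 + 4 * η) * ε) :
    d ≤ ε + (κ + 2 * ε - 1) ^ (1 / 2 : ℝ) := by
  rw [← tsub_le_iff_left]
  by_cases htop : κ + 2 * ε = ∞
  · simp [htop]
  obtain ⟨hκ, hε⟩ := ENNReal.add_ne_top.1 htop
  replace hε : ε ≠ ∞ := fun h => hε (by simp [h])
  have hsq : (d - ε) ^ 2 ≤ κ + 2 * ε - 1 := by
    rcases le_total d ε with hle | hle
    · simp [tsub_eq_zero_of_le hle]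
    obtain ⟨t, rfl⟩ := exists_add_of_le hle
    lift ε to ℝ≥0 using hε
    lift κ to ℝ≥0 using hκ
    lift t to ℝ≥0 using (ENNReal.add_ne_top.1 hd).2
    have hη := h ((t / 2 : ℝ≥0) : ℝ≥0∞) ENNReal.coe_ne_top
    rw [ENNReal.add_sub_cancel_left ENNReal.coe_ne_top]
    refine ENNReal.le_sub_of_add_le_right ENNReal.one_ne_top ?_
    norm_cast at hη ⊢
    rw [← NNReal.coe_le_coe] at hη ⊢
    push_cast at hη ⊢
    linarith
  calc d - ε = ((d - ε) ^ 2) ^ (1 / 2 : ℝ) := by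
        rw [← ENNReal.rpow_natCast, ← ENNReal.rpow_mul]; norm_num
    _ ≤ (κ + 2 * ε - 1) ^ (1 / 2 : ℝ) := ENNReal.rpow_le_rpow hsq (by norm_num)

/-! ### Conditional laws of the source -/

section CondWeight

theorem fiberMass_measure_singleton {α Γ : Type*} [MeasurableSpace α] [Countable α]
    [MeasurableSingletonClass α] (μ : Measure α) (φ : α → Γ) (a : Γ) :
    fiberMass (fun x => μ {x}) φ a = μ (φ ⁻¹' {a}) :=
  Measure.tsum_indicator_apply_singleton μ _ (Set.to_countable _).measurableSet

theorem tsum_measure_singleton {α : Type*} [MeasurableSpace α] [Countable α]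
    [MeasurableSingletonClass α] (μ : Measure α) : ∑' x, μ {x} = μ Set.univ := by
  simpa using Measure.tsum_indicator_apply_singleton μ Set.univ MeasurableSet.univ

variable {S : Type*} [Finite S] {Z : S → Type*} [∀ s, MeasurableSpace (Z s)]
  [∀ s, MeasurableSingletonClass (Z s)]

theorem condWeight_eq_map_cond (μ : Measure (∀ s, Z s)) (T T' : Finset S) (z' : ∀ s : T', Z s)
    (w : ∀ s : T, Z s) :
    condWeight μ T T' z' w = (μ[|T'.restrict ⁻¹' {z'}]).map T.restrict {w} := by
  rw [Measure.map_apply (Finset.measurable_restrict T) (measurableSet_singleton w),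
    cond_apply (Finset.measurable_restrict T' (measurableSet_singleton z')), condWeight,
    ENNReal.div_eq_inv_mul]
  congr 2
  ext z
  exact and_comm

variable [∀ s, Countable (Z s)]

theorem fiberMass_condWeight {Γ : Type*} (μ : Measure (∀ s, Z s)) (T T' : Finset S)
    (z' : ∀ s : T', Z s) (φ : (∀ s : T, Z s) → Γ) (a : Γ) :
    fiberMass (condWeight μ T T' z') φ a =
      μ {z | φ (T.restrict z) = a ∧ T'.restrict z = z'} / μ {z | T'.restrict z = z'} := by
  rw [funext (condWeight_eq_map_cond μ T T' z'), fiberMass_measure_singleton,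
    Measure.map_apply (Finset.measurable_restrict T) (Set.to_countable _).measurableSet,
    cond_apply (Finset.measurable_restrict T' (measurableSet_singleton z')),
    ENNReal.div_eq_inv_mul]
  congr 2
  ext z
  exact and_comm

theorem tsum_condWeight (μ : Measure (∀ s, Z s)) (T T' : Finset S) (z' : ∀ s : T', Z s) :
    ∑' w, condWeight μ T T' z' w = μ[|T'.restrict ⁻¹' {z'}] Set.univ := by
  rw [funext (condWeight_eq_map_cond μ T T' z'), tsum_measure_singleton,
    Measure.map_apply (Finset.measurable_restrict T) MeasurableSet.univ, Set.preimage_univ]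

theorem tsum_condWeight_le_one (μ : Measure (∀ s, Z s)) (T T' : Finset S) (z' : ∀ s : T', Z s) :
    ∑' w, condWeight μ T T' z' w ≤ 1 :=
  (tsum_condWeight μ T T' z').trans_le prob_le_one

theorem tsum_condWeight_eq_one (μ : Measure (∀ s, Z s)) [IsFiniteMeasure μ] (T T' : Finset S)
    {z : ∀ s, Z s} (hz : μ {z} ≠ 0) : ∑' w, condWeight μ T T' (T'.restrict z) w = 1 := by
  have : μ (T'.restrict ⁻¹' {T'.restrict z}) ≠ 0 := fun h =>
    hz (measure_mono_null (fun x (hx : x = z) => congrArg T'.restrict hx) h)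
  have := cond_isProbabilityMeasure this
  rw [tsum_condWeight, measure_univ]

theorem tsum_mul_tsum_condWeight_mul (μ : Measure (∀ s, Z s)) [IsFiniteMeasure μ]
    (T T' : Finset S) (ψ : (∀ s : T', Z s) → (∀ s : T, Z s) → ℝ≥0∞) :
    ∑' z, μ {z} * ∑' w, condWeight μ T T' (T'.restrict z) w * ψ (T'.restrict z) w =
      ∑' z, μ {z} * ψ (T'.restrict z) (T.restrict z) := by
  have hjoint : ∀ a w, fiberMass (fun z => μ {z}) T'.restrict a * condWeight μ T T' a w =
      fiberMass (fun z => μ {z}) (fun z => (T'.restrict z, T.restrict z)) (a, w) := fun a w => by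
    have hset : {z : ∀ s, Z s | T.restrict z = w ∧ T'.restrict z = a} =
        (fun z => (T'.restrict z, T.restrict z)) ⁻¹' {(a, w)} := by
      ext z
      simp [and_comm]
    rw [fiberMass_measure_singleton, fiberMass_measure_singleton, ← hset]
    exact ENNReal.mul_div_cancel' (fun h => measure_mono_null (fun z hz => hz.2) h)
      (fun h => absurd h (measure_ne_top _ _))
  calc ∑' z, μ {z} * ∑' w, condWeight μ T T' (T'.restrict z) w * ψ (T'.restrict z) w
      = ∑' a, ∑' w, fiberMass (fun z => μ {z}) T'.restrict a * condWeight μ T T' a w * ψ a w := by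
        rw [tsum_mul_comp_eq_tsum_fiberMass _ _ fun a => ∑' w, condWeight μ T T' a w * ψ a w]
        simp_rw [← ENNReal.tsum_mul_left, mul_assoc]
    _ = ∑' z, μ {z} * ψ (T'.restrict z) (T.restrict z) := by
        simp_rw [hjoint]
        rw [← ENNReal.tsum_prod (f := fun a w => fiberMass (fun z => μ {z}) _ (a, w) * ψ a w)]
        exact (tsum_mul_comp_eq_tsum_fiberMass (fun z => μ {z})
          (fun z => (T'.restrict z, T.restrict z)) fun p => ψ p.1 p.2).symm

theorem tsum_mul_tsum_indicator_condWeight (μ : Measure (∀ s, Z s)) [IsFiniteMeasure μ]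
    (T T' : Finset S) (U : (∀ s : T', Z s) → Set (∀ s : T, Z s)) :
    ∑' z, μ {z} * ∑' w, (U (T'.restrict z)).indicator (condWeight μ T T' (T'.restrict z)) w =
      μ {z | T.restrict z ∈ U (T'.restrict z)} := by
  have h := tsum_mul_tsum_condWeight_mul μ T T' fun z' w => (U z').indicator 1 w
  simp_rw [← Set.indicator_mul_right, Pi.one_apply, mul_one] at h
  rw [h, ← Measure.tsum_indicator_apply_singleton μ _ (Set.to_countable _).measurableSet]
  classical
  simp only [Set.indicator_apply, Set.mem_ofPred_eq, Pi.one_apply, mul_ite, mul_one, mul_zero]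

end CondWeight

/-! ### The encoders -/

section Encoder

theorem div_fiberMass_le_constrainedGenerator {α Γ : Type*} (w : α → ℝ≥0∞) (hw : ∑' x, w x ≠ ∞)
    (φ : α → Γ) (x : α) :
    w x / fiberMass w φ (φ x) ≤ constrainedGenerator w (φ ⁻¹' {φ x}) (some x) := by
  classical
  by_cases h0 : fiberMass w φ (φ x) = 0
  · simp [le_zero_iff.1 (h0 ▸ le_fiberMass w φ x)]
  · have hfin : fiberMass w φ (φ x) ≠ ∞ := ne_top_of_le_ne_top hw (fiberMass_le_tsum w φ _)
    rw [constrainedGenerator, dif_pos ⟨h0, hfin⟩, PMF.map_apply]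
    refine le_trans ?_ (ENNReal.le_tsum x)
    simp [PMF.normalize_apply, div_eq_mul_inv, fiberMass]

variable {S : Type*} {Z C M : S → Type*}

/-- The vector of the values `f_s(w_s)`, `s ∈ T`. -/
def hashVector (T : Finset S) (f : ∀ s, Z s → C s) (w : ∀ s : T, Z s) : ∀ s : T, C s :=
  fun s => f s (w s)

/-- The functions `x ↦ (f_s(x), g_s(x))`, whose values are prescribed in the encoding steps. -/
def hashPair (f : ∀ s, Z s → C s) (g : ∀ s, Z s → M s) (s : S) (x : Z s) : C s × M s :=
  (f s x, g s x)

theorem fiber_eq_preimage_hashVector (T : Finset S) (f : ∀ s, Z s → C s) (z : ∀ s, Z s) :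
    fiber T f (T.restrict fun s => f s (z s)) =
      hashVector T f ⁻¹' {hashVector T f (T.restrict z)} := by
  ext w
  exact funext_iff.symm

theorem fiber_inter_fiber_eq_preimage_hashVector (T : Finset S) (f : ∀ s, Z s → C s)
    (g : ∀ s, Z s → M s) (z : ∀ s, Z s) :
    fiber T f (T.restrict fun s => f s (z s)) ∩ fiber T g (T.restrict fun s => g s (z s)) =
      hashVector T (hashPair f g) ⁻¹' {hashVector T (hashPair f g) (T.restrict z)} := by
  ext w
  simp only [fiber, hashVector, hashPair, Set.mem_inter_iff, Set.mem_ofPred_eq, funext_iff,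
    Prod.mk.injEq, Finset.restrict, forall_and, Set.mem_preimage, Set.mem_singleton_iff]

theorem inv_card_pi_eq_prod [DecidableEq S] [∀ s, Fintype (C s)] (T : Finset S) :
    (Fintype.card (∀ s : T, C s) : ℝ≥0∞)⁻¹ = ∏ s ∈ T, (Fintype.card (C s) : ℝ≥0∞)⁻¹ := by
  rw [Fintype.card_pi, Nat.cast_prod, ENNReal.prod_inv_distrib, ← Finset.prod_coe_sort T]
  intro s _ t _ _
  simp

theorem inv_card_prod_eq_mul {α β : Type*} [Fintype α] [Fintype β] :
    (Fintype.card (α × β) : ℝ≥0∞)⁻¹ = (Fintype.card α : ℝ≥0∞)⁻¹ * (Fintype.card β : ℝ≥0∞)⁻¹ := by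
  rw [Fintype.card_prod, Nat.cast_mul, ENNReal.mul_inv] <;> simp

variable {I : Type*} [Fintype S] [Fintype I] [DecidableEq S] [DecidableEq I]

theorem mem_privateMessages {A : Finset (S × I)} {I' : Finset I} {s : S} :
    s ∈ privateMessages A I' ↔ encodersOf A s = I' := by
  simp [privateMessages]

theorem encodersOf_mem_accessFamily (A : Finset (S × I)) (s : S) :
    encodersOf A s ∈ accessFamily A :=
  Finset.mem_filter.2 ⟨Finset.mem_univ _, s, mem_privateMessages.2 rfl⟩

theorem mem_publicMessages {A : Finset (S × I)} {I' : Finset I} {s : S} :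
    s ∈ publicMessages A I' ↔ I' ⊂ encodersOf A s := by
  simp only [publicMessages, Finset.mem_biUnion, Finset.mem_filter, mem_privateMessages]
  refine ⟨?_, fun h => ⟨_, ⟨encodersOf_mem_accessFamily A s, h⟩, rfl⟩⟩
  rintro ⟨_, ⟨-, h⟩, rfl⟩
  exact h

theorem prod_accessFamily_prod_privateMessages (A : Finset (S × I)) (a : S → ℝ≥0∞) :
    ∏ I' ∈ accessFamily A, ∏ s ∈ privateMessages A I', a s = ∏ s, a s :=
  Finset.prod_fiberwise_of_maps_to (fun s _ => encodersOf_mem_accessFamily A s) a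

variable [∀ s, MeasurableSpace (Z s)]

theorem prod_encoderGenerator_le_encoderRun (A : Finset (S × I)) (μ : Measure (∀ s, Z s))
    (f : ∀ s, Z s → C s) (g : ∀ s, Z s → M s) (c : ∀ s, C s) (m : ∀ s, M s) (z : ∀ s, Z s)
    (L : List (Finset I)) (hnd : L.Nodup) (hL : L.Pairwise fun I₁ I₂ => ¬ I₁ ⊂ I₂)
    (x : ∀ s, Z s) (hx : ∀ s, encodersOf A s ∉ L → x s = z s) :
    (L.map fun I' => encoderGenerator A μ f g I' ((publicMessages A I').restrict z)
        ((privateMessages A I').restrict c) ((privateMessages A I').restrict m)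
        (some ((privateMessages A I').restrict z))).prod ≤
      encoderRun A μ f g c m L x (some z) := by
  induction L generalizing x with
  | nil =>
    obtain rfl : x = z := funext fun s => hx s List.not_mem_nil
    simp [encoderRun]
  | cons I' L ih =>
    rw [List.nodup_cons] at hnd
    rw [List.pairwise_cons] at hL
    have hpub : (publicMessages A I').restrict x = (publicMessages A I').restrict z := by
      funext ⟨s, hs⟩
      refine hx s fun hmem => ?_
      have hlt := mem_publicMessages.1 hs
      rcases List.mem_cons.1 hmem with heq | hmem
      · exact (heq ▸ hlt).ne rfl
      · exact hL.1 _ hmem hlt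
    have hnext : ∀ s, encodersOf A s ∉ L →
        overwrite (privateMessages A I') x ((privateMessages A I').restrict z) s = z s := by
      intro s hs
      by_cases h : s ∈ privateMessages A I'
      · simp [overwrite, h]
      · simp only [overwrite, h, dite_false]
        refine hx s fun hmem => ?_
        rcases List.mem_cons.1 hmem with heq | hmem
        · exact h (mem_privateMessages.2 heq)
        · exact hs hmem
    rw [List.map_cons, List.prod_cons, encoderRun, PMF.bind_apply, hpub]
    exact (mul_le_mul' le_rfl (ih hnd.2 hL.2 _ hnext)).trans (ENNReal.le_tsum
      (f := fun o => encoderGenerator A μ f g I' _ _ _ o * _) (some _))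

variable [∀ s, Fintype (C s)] [∀ s, Fintype (M s)]

/-- The density, truncated at `1`, of the vector generated in the step of `I'` with respect to the
source, if the values of the functions `f_s` and `g_s` are prescribed at random. -/
def stepDensity (A : Finset (S × I)) (μ : Measure (∀ s, Z s)) (f : ∀ s, Z s → C s)
    (g : ∀ s, Z s → M s) (I' : Finset I) (z : ∀ s, Z s) : ℝ≥0∞ :=
  fiberDensity (condWeight μ (privateMessages A I') (publicMessages A I')
    ((publicMessages A I').restrict z)) (hashVector (privateMessages A I') (hashPair f g))
    ((privateMessages A I').restrict z)

theorem stepDensity_le_one (A : Finset (S × I)) (μ : Measure (∀ s, Z s)) (f : ∀ s, Z s → C s)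
    (g : ∀ s, Z s → M s) (I' : Finset I) (z : ∀ s, Z s) : stepDensity A μ f g I' z ≤ 1 :=
  min_le_left _ _

variable [∀ s, Countable (Z s)] [∀ s, MeasurableSingletonClass (Z s)]

theorem condWeight_mul_stepDensity_le (A : Finset (S × I)) (μ : Measure (∀ s, Z s))
    (f : ∀ s, Z s → C s) (g : ∀ s, Z s → M s) (I' : Finset I) (z : ∀ s, Z s) :
    condWeight μ (privateMessages A I') (publicMessages A I') ((publicMessages A I').restrict z)
        ((privateMessages A I').restrict z) * stepDensity A μ f g I' z ≤
      (Fintype.card (∀ s : privateMessages A I', C s × M s) : ℝ≥0∞)⁻¹ *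
        encoderGenerator A μ f g I' ((publicMessages A I').restrict z)
          ((privateMessages A I').restrict fun s => f s (z s))
          ((privateMessages A I').restrict fun s => g s (z s))
          (some ((privateMessages A I').restrict z)) := by
  set q := condWeight μ (privateMessages A I') (publicMessages A I')
    ((publicMessages A I').restrict z)
  set w := (privateMessages A I').restrict z
  have hq : ∑' w, q w ≠ ∞ :=
    ne_top_of_le_ne_top ENNReal.one_ne_top (tsum_condWeight_le_one μ _ _ _)
  calc q w * stepDensity A μ f g I' z
      ≤ q w * ((Fintype.card (∀ s : privateMessages A I', C s × M s) : ℝ≥0∞)⁻¹ /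
          fiberMass q (hashVector (privateMessages A I') (hashPair f g))
            (hashVector (privateMessages A I') (hashPair f g) w)) :=
        mul_le_mul' le_rfl (min_le_right _ _)
    _ = (Fintype.card (∀ s : privateMessages A I', C s × M s) : ℝ≥0∞)⁻¹ *
          (q w / fiberMass q (hashVector (privateMessages A I') (hashPair f g))
            (hashVector (privateMessages A I') (hashPair f g) w)) := by
        simp only [div_eq_mul_inv]
        exact mul_left_comm _ _ _
    _ ≤ _ := by
        rw [encoderGenerator, fiber_inter_fiber_eq_preimage_hashVector]
        exact mul_le_mul' le_rfl (div_fiberMass_le_constrainedGenerator q hq _ w)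

theorem measure_mul_prod_stepDensity_le (A : Finset (S × I)) (L : List (Finset I))
    (hL : IsReverseLinearExtension A L) (μ : Measure (∀ s, Z s)) (hμ : IsConsistent A μ)
    (f : ∀ s, Z s → C s) (g : ∀ s, Z s → M s) (x z : ∀ s, Z s) :
    μ {z} * ∏ I' ∈ accessFamily A, stepDensity A μ f g I' z ≤
      (∏ s, (Fintype.card (C s) : ℝ≥0∞)⁻¹) * ((∏ s, (Fintype.card (M s) : ℝ≥0∞)⁻¹) *
        encoderRun A μ f g (fun s => f s (z s)) (fun s => g s (z s)) L x (some z)) := by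
  obtain ⟨hnd, hmem, hpw⟩ := hL
  have hset : L.toFinset = accessFamily A := by
    ext I'
    rw [List.mem_toFinset, hmem]
  have hcard : ∏ I' ∈ accessFamily A,
        (Fintype.card (∀ s : privateMessages A I', C s × M s) : ℝ≥0∞)⁻¹ =
      (∏ s, (Fintype.card (C s) : ℝ≥0∞)⁻¹) * ∏ s, (Fintype.card (M s) : ℝ≥0∞)⁻¹ := by
    rw [Finset.prod_congr rfl fun I' _ => inv_card_pi_eq_prod (C := fun s => C s × M s) _]
    simp_rw [inv_card_prod_eq_mul]
    rw [prod_accessFamily_prod_privateMessages A fun s =>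
      (Fintype.card (C s) : ℝ≥0∞)⁻¹ * (Fintype.card (M s) : ℝ≥0∞)⁻¹, Finset.prod_mul_distrib]
  have hrun := prod_encoderGenerator_le_encoderRun A μ f g (fun s => f s (z s))
    (fun s => g s (z s)) z L hnd hpw x
    fun s hs => absurd ((hmem _).2 (encodersOf_mem_accessFamily A s)) hs
  rw [← List.prod_toFinset _ hnd, hset] at hrun
  rw [← mul_assoc, ← hcard, hμ z, ← Finset.prod_mul_distrib]
  refine le_trans ?_ (mul_le_mul' le_rfl hrun)
  rw [← Finset.prod_mul_distrib]
  exact Finset.prod_le_prod' fun I' _ => condWeight_mul_stepDensity_le A μ f g I' z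

end Encoder

section Coupling

theorem one_sub_prod_le_sum {ι : Type*} (s : Finset ι) (ρ : ι → ℝ≥0∞) (hρ : ∀ i, ρ i ≤ 1) :
    1 - ∏ i ∈ s, ρ i ≤ ∑ i ∈ s, (1 - ρ i) := by
  classical
  induction s using Finset.induction_on with
  | empty => simp
  | insert i s hi ih =>
    rw [Finset.prod_insert hi, Finset.sum_insert hi, tsub_le_iff_right]
    rw [tsub_le_iff_right] at ih
    calc (1 : ℝ≥0∞) = 1 - ρ i + ρ i := (tsub_add_cancel_of_le (hρ i)).symm
      _ ≤ 1 - ρ i + ρ i * (∑ i ∈ s, (1 - ρ i) + ∏ i ∈ s, ρ i) := by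
        gcongr
        exact le_mul_of_one_le_right zero_le ih
      _ ≤ 1 - ρ i + (∑ i ∈ s, (1 - ρ i) + ρ i * ∏ i ∈ s, ρ i) := by
        rw [mul_add]
        gcongr
        exact mul_le_of_le_one_left zero_le (hρ i)
      _ = _ := (add_assoc _ _ _).symm

theorem tsum_mul_le_of_mul_le_comp {α β : Type*} {P : β → ℝ≥0∞} {Q ρ : α → ℝ≥0∞} {e : α → β}
    (hP : ∑' y, P y = 1) (hQ : ∑' x, Q x = 1) (hρ : ∀ x, ρ x ≤ 1) (he : Function.Injective e)
    (h : ∀ x, Q x * ρ x ≤ P (e x)) {E : β → ℝ≥0∞} (hE : ∀ y, E y ≤ 1) :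
    ∑' y, P y * E y ≤ ∑' x, Q x * E (e x) + ∑' x, Q x * (1 - ρ x) := by
  have hsplit : ∀ x, Q x ≤ Q x * E (e x) + Q x * (1 - ρ x) + Q x * ρ x * (1 - E (e x)) :=
    fun x => by
      calc Q x = Q x * (1 - ρ x + ρ x * (E (e x) + (1 - E (e x)))) := by
            rw [add_tsub_cancel_of_le (hE _), mul_one, tsub_add_cancel_of_le (hρ x), mul_one]
        _ = Q x * (ρ x * E (e x)) + Q x * (1 - ρ x) + Q x * ρ x * (1 - E (e x)) := by ring
        _ ≤ _ := by
            gcongr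
            exact mul_le_of_le_one_left' (hρ x)
  have hco : ∑' x, Q x * ρ x * (1 - E (e x)) ≤ ∑' y, P y * (1 - E y) :=
    (ENNReal.tsum_le_tsum fun x => mul_le_mul' (h x) le_rfl).trans
      (ENNReal.tsum_comp_le_tsum_of_injective he fun y => P y * (1 - E y))
  have hfin : ∑' x, Q x * ρ x * (1 - E (e x)) ≠ ∞ := by
    refine ne_top_of_le_ne_top (hP ▸ ENNReal.one_ne_top) (hco.trans ?_)
    exact ENNReal.tsum_le_tsum fun y => mul_le_of_le_one_right' tsub_le_self
  rw [← ENNReal.add_le_add_iff_right hfin]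
  calc ∑' y, P y * E y + ∑' x, Q x * ρ x * (1 - E (e x))
      ≤ ∑' y, P y * E y + ∑' y, P y * (1 - E y) := add_le_add le_rfl hco
    _ = ∑' x, Q x := by
        simp_rw [← ENNReal.tsum_add, ← mul_add, add_tsub_cancel_of_le (hE _), mul_one, hP, hQ]
    _ ≤ _ := by
        simp_rw [← ENNReal.tsum_add]
        exact ENNReal.tsum_le_tsum hsplit

theorem sum_prod_inv_card {S : Type*} [Fintype S] [DecidableEq S] {X : S → Type*}
    [∀ s, Fintype (X s)] [∀ s, Nonempty (X s)] :
    ∑ _x : ∀ s, X s, ∏ s, (Fintype.card (X s) : ℝ≥0∞)⁻¹ = 1 := by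
  rw [Finset.sum_const, Finset.card_univ, nsmul_eq_mul, Fintype.card_pi, Nat.cast_prod,
    ← Finset.prod_mul_distrib]
  exact Finset.prod_eq_one fun s _ =>
    ENNReal.mul_inv_cancel (by simp) (ENNReal.natCast_ne_top _)

variable {S I : Type*} [Fintype S] [Fintype I] [DecidableEq S] [DecidableEq I]
  {Z C M : S → Type*} [∀ s, MeasurableSpace (Z s)]
  [∀ s, Fintype (C s)] [∀ s, Fintype (M s)] [∀ s, Nonempty (C s)] [∀ s, Nonempty (M s)]
  [∀ s, Countable (Z s)] [∀ s, MeasurableSingletonClass (Z s)]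

theorem sum_encoderRun_mul_le (A : Finset (S × I)) (L : List (Finset I))
    (hL : IsReverseLinearExtension A L) (μ : Measure (∀ s, Z s)) [IsProbabilityMeasure μ]
    (hμ : IsConsistent A μ) (f : ∀ s, Z s → C s) (g : ∀ s, Z s → M s) (x : ∀ s, Z s)
    (E : (∀ s, C s) → (∀ s, M s) → Option (∀ s, Z s) → ℝ≥0∞) (hE : ∀ c m o, E c m o ≤ 1) :
    ∑ c : ∀ s, C s, (∏ s, (Fintype.card (C s) : ℝ≥0∞)⁻¹) *
        ∑ m : ∀ s, M s, (∏ s, (Fintype.card (M s) : ℝ≥0∞)⁻¹) *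
          ∑' o, encoderRun A μ f g c m L x o * E c m o ≤
      ∑' z, μ {z} * E (fun s => f s (z s)) (fun s => g s (z s)) (some z) +
        ∑ I' ∈ accessFamily A, ∑' z, μ {z} * (1 - stepDensity A μ f g I' z) := by
  let P (t : (∀ s, C s) × (∀ s, M s) × Option (∀ s, Z s)) : ℝ≥0∞ :=
    (∏ s, (Fintype.card (C s) : ℝ≥0∞)⁻¹) * ((∏ s, (Fintype.card (M s) : ℝ≥0∞)⁻¹) *
      encoderRun A μ f g t.1 t.2.1 L x t.2.2)
  let e (z : ∀ s, Z s) : (∀ s, C s) × (∀ s, M s) × Option (∀ s, Z s) :=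
    (fun s => f s (z s), fun s => g s (z s), some z)
  have he : Function.Injective e := fun z z' h => Option.some_injective _ (congrArg (·.2.2) h)
  have hexpand : ∀ F : (∀ s, C s) → (∀ s, M s) → Option (∀ s, Z s) → ℝ≥0∞,
      ∑' t, P t * F t.1 t.2.1 t.2.2 =
        ∑ c : ∀ s, C s, (∏ s, (Fintype.card (C s) : ℝ≥0∞)⁻¹) *
          ∑ m : ∀ s, M s, (∏ s, (Fintype.card (M s) : ℝ≥0∞)⁻¹) *
            ∑' o, encoderRun A μ f g c m L x o * F c m o := fun F => by
    simp_rw [P, ENNReal.tsum_prod', mul_assoc, ENNReal.tsum_mul_left, tsum_fintype,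
      Finset.mul_sum]
  have hP : ∑' t, P t = 1 := by
    simpa only [mul_one, PMF.tsum_coe, ← Finset.sum_mul, sum_prod_inv_card] using
      hexpand fun _ _ _ => 1
  rw [← hexpand]
  refine (tsum_mul_le_of_mul_le_comp hP ((tsum_measure_singleton μ).trans measure_univ)
    (fun z => Finset.prod_le_one' fun I' _ => stepDensity_le_one A μ f g I' z) he
    (measure_mul_prod_stepDensity_le A L hL μ hμ f g x) fun t => hE _ _ _).trans
    (add_le_add le_rfl ?_)
  rw [← Summable.tsum_finsetSum fun _ _ => ENNReal.summable]
  simp_rw [← Finset.mul_sum]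
  exact ENNReal.tsum_le_tsum fun z => mul_le_mul' le_rfl
    (one_sub_prod_le_sum _ _ fun I' => stepDensity_le_one A μ f g I' z)

end Coupling

/-! ### Almost universal random functions -/

section AlmostUniversal

/-- A random function `φ ω` is `(a, b)`-almost universal if, for every `x`, all but a few elements
collide with `x` with probability at most `a / |Γ|`, and the sum of the collision probabilities of
the exceptional ones is at most `b`. For the canonical random function of an ensemble `E` with
`Im E = Γ` this is the `(a, b)`-hash property. -/
def IsAlmostUniversal {Ω α Γ : Type*} [MeasurableSpace Ω] [Fintype Γ] (ν : Measure Ω)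
    (φ : Ω → α → Γ) (a b : ℝ≥0∞) : Prop :=
  ∀ x, ∃ E : Set α, x ∉ E ∧
    (∀ x' ∉ E, x' ≠ x → ν {ω | φ ω x' = φ ω x} ≤ a / (Fintype.card Γ : ℝ≥0∞)) ∧
    ∑' x', E.indicator (fun x' => ν {ω | φ ω x' = φ ω x}) x' ≤ b

instance {α γ : Type*} [MeasurableSpace γ] (E : Ensemble α γ) : IsProbabilityMeasure E.law :=
  E.isProbabilityMeasure

theorem Ensemble.IsHash.isAlmostUniversal {α γ : Type*} [MeasurableSpace γ] [Fintype γ]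
    {E : Ensemble α γ} {a b : ℝ≥0} (h : E.IsHash a b) (him : E.im = Set.univ) :
    IsAlmostUniversal E.law id a b := by
  have hcard : (Fintype.card γ : ℝ≥0∞) = (E.im.ncard : ℝ≥0∞) := by
    rw [him, Set.ncard_univ, Nat.card_eq_fintype_card]
  have hcomm : ∀ x x', {f : α → γ | id f x' = id f x} = {f | f x = f x'} := fun x x' =>
    Set.ext fun _ => eq_comm
  intro x
  refine ⟨{x' | x' ≠ x ∧ (a : ℝ≥0∞) / (E.im.ncard : ℝ≥0∞) < E.law {f | f x = f x'}},
    fun hx => hx.1 rfl, fun x' hx' hne => ?_, ?_⟩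
  · rw [hcard, hcomm]
    exact not_lt.1 fun hlt => hx' ⟨hne, hlt⟩
  · refine le_trans (ENNReal.tsum_le_tsum fun x' => ?_) (h x)
    simp only [hcomm]
    exact Set.indicator_apply_le' (fun hx' => (if_pos hx').ge) fun _ => zero_le

section Prod

variable {Ω Ω' α Γ Γ' : Type*} [MeasurableSpace Ω] [MeasurableSpace Ω'] [Fintype Γ] [Fintype Γ']
  {ν : Measure Ω} {ν' : Measure Ω'} [IsProbabilityMeasure ν'] {φ : Ω → α → Γ}
  {φ' : Ω' → α → Γ'} {a b a' b' : ℝ≥0∞}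

theorem IsAlmostUniversal.comp_fst (h : IsAlmostUniversal ν φ a b) :
    IsAlmostUniversal (ν.prod ν') (fun p => φ p.1) a b := by
  have hfst : ∀ x x', ν.prod ν' {p | φ p.1 x' = φ p.1 x} = ν {ω | φ ω x' = φ ω x} :=
    fun x x' => by
      have : {p : Ω × Ω' | φ p.1 x' = φ p.1 x} = {ω | φ ω x' = φ ω x} ×ˢ Set.univ := by
        ext
        simp
      rw [this, Measure.prod_prod, measure_univ, mul_one]
  simpa only [IsAlmostUniversal, hfst] using h

theorem IsAlmostUniversal.prodMk [IsProbabilityMeasure ν] (h : IsAlmostUniversal ν φ a b)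
    (h' : IsAlmostUniversal ν' φ' a' b') :
    IsAlmostUniversal (ν.prod ν') (fun p x => (φ p.1 x, φ' p.2 x)) (a * a') (b + b') := by
  classical
  have hprod : ∀ x x', ν.prod ν' {p | (φ p.1 x', φ' p.2 x') = (φ p.1 x, φ' p.2 x)} =
      ν {ω | φ ω x' = φ ω x} * ν' {ω | φ' ω x' = φ' ω x} := fun x x' => by
    rw [← Measure.prod_prod]
    congr 1
    ext
    simp
  intro x
  obtain ⟨E, hx, ha, hb⟩ := h x
  obtain ⟨E', hx', ha', hb'⟩ := h' x
  refine ⟨E ∪ E', fun hmem => hmem.elim hx hx', fun x' hmem hne => ?_, ?_⟩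
  · rw [Set.mem_union, not_or] at hmem
    rw [hprod, div_eq_mul_inv, inv_card_prod_eq_mul, mul_mul_mul_comm, ← div_eq_mul_inv,
      ← div_eq_mul_inv]
    exact mul_le_mul' (ha x' hmem.1 hne) (ha' x' hmem.2 hne)
  · simp_rw [hprod]
    calc ∑' x', (E ∪ E').indicator
            (fun x' => ν {ω | φ ω x' = φ ω x} * ν' {ω | φ' ω x' = φ' ω x}) x'
        ≤ ∑' x', (E.indicator (fun x' => ν {ω | φ ω x' = φ ω x}) x' +
            E'.indicator (fun x' => ν' {ω | φ' ω x' = φ' ω x}) x') := by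
          refine ENNReal.tsum_le_tsum fun x' => Set.indicator_apply_le' ?_ fun _ => zero_le
          rintro (hmem | hmem)
          · rw [Set.indicator_of_mem hmem]
            exact le_add_right (mul_le_of_le_one_right zero_le prob_le_one)
          · rw [Set.indicator_of_mem hmem]
            exact le_add_left (mul_le_of_le_one_left zero_le prob_le_one)
      _ ≤ b + b' := by
          rw [ENNReal.tsum_add]
          exact add_le_add hb hb'

end Prod

variable {S : Type*} {Ω Z Γ : S → Type*} {φ : ∀ s, Ω s → Z s → Γ s}

theorem setOf_hashVector_eq (T : Finset S) (w w' : ∀ s : T, Z s) :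
    {h : ∀ s, Ω s | hashVector T (fun s => φ s (h s)) w' = hashVector T (fun s => φ s (h s)) w} =
      T.restrict ⁻¹' Set.univ.pi fun s : T => {ω | φ s ω (w' s) = φ s ω (w s)} := by
  ext h
  simp [hashVector, funext_iff]

variable [∀ s, MeasurableSpace (Ω s)]

theorem measurableSet_setOf_hashVector_eq
    (hφ : ∀ s x x', MeasurableSet {ω | φ s ω x' = φ s ω x}) (T : Finset S) (w w' : ∀ s : T, Z s) :
    MeasurableSet {h : ∀ s, Ω s |
      hashVector T (fun s => φ s (h s)) w' = hashVector T (fun s => φ s (h s)) w} := by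
  rw [setOf_hashVector_eq]
  exact Finset.measurable_restrict T
    (MeasurableSet.univ_pi fun s => hφ s (w s) (w' s))

theorem pi_setOf_hashVector_eq [Fintype S] (ν : ∀ s, Measure (Ω s))
    [∀ s, IsProbabilityMeasure (ν s)]
    (hφ : ∀ s x x', MeasurableSet {ω | φ s ω x' = φ s ω x}) (T : Finset S) (w w' : ∀ s : T, Z s) :
    Measure.pi ν {h | hashVector T (fun s => φ s (h s)) w' = hashVector T (fun s => φ s (h s)) w} =
      ∏ s : T, ν s {ω | φ s ω (w' s) = φ s ω (w s)} := by
  rw [setOf_hashVector_eq, ← Measure.map_apply (Finset.measurable_restrict T)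
    (MeasurableSet.univ_pi fun s => hφ s (w s) (w' s)), ← Measure.infinitePi_eq_pi,
    Measure.infinitePi_map_restrict, Measure.pi_pi]

end AlmostUniversal

/-! ### The mean deficit of an encoding step -/

section EncoderAverage

variable {S : Type*} [Fintype S] {Z : S → Type*} [∀ s, MeasurableSpace (Z s)]

/-- The vectors `w` such that `μ(w_O | z') ≤ B O` for all sets `O` of coordinates. -/
def condTypical (μ : Measure (∀ s, Z s)) (T T' : Finset S) (B : Finset T → ℝ≥0∞)
    (z' : ∀ s : T', Z s) : Set (∀ s : T, Z s) :=
  {w | ∀ O : Finset T, fiberMass (condWeight μ T T' z') O.restrict (O.restrict w) ≤ B O}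

/-- A bound, for hash functions with values in `Γ s`, on the number of hash values times the mean
probability that two typical vectors have the same hash values; `O` is the set of the coordinates
in which the two vectors agree or collide exceptionally. -/
def secondMomentBound [DecidableEq S] (T : Finset S) (Γ : S → Type*) [∀ s, Fintype (Γ s)]
    (a b : S → ℝ≥0∞) (B : Finset T → ℝ≥0∞) : ℝ≥0∞ :=
  (Fintype.card (∀ s : T, Γ s) : ℝ≥0∞) *
    ∑ O : Finset T, (∏ s ∈ Oᶜ, a s / (Fintype.card (Γ s) : ℝ≥0∞)) * ((∏ s ∈ O, (1 + b s)) * B O)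

variable [DecidableEq S]

/-- The bound on the mean deficit of an encoding step that the second moment bound gives. -/
def deficitBound (μ : Measure (∀ s, Z s)) (T T' : Finset S) (Γ : S → Type*) [∀ s, Fintype (Γ s)]
    (a b : S → ℝ≥0∞) (B : Finset T → ℝ≥0∞) : ℝ≥0∞ :=
  μ {z | T.restrict z ∉ condTypical μ T T' B (T'.restrict z)} +
    (secondMomentBound T Γ a b B +
      2 * μ {z | T.restrict z ∉ condTypical μ T T' B (T'.restrict z)} - 1) ^ (1 / 2 : ℝ)

variable {Ω Γ : S → Type*} [∀ s, MeasurableSpace (Ω s)]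
  [∀ s, Fintype (Γ s)] {φ : ∀ s, Ω s → Z s → Γ s}
  (hφ : ∀ s x x', MeasurableSet {ω | φ s ω x' = φ s ω x}) {ν : ∀ s, Measure (Ω s)}
  [∀ s, IsProbabilityMeasure (ν s)] {a b : S → ℝ≥0∞}
  (hν : ∀ s, IsAlmostUniversal (ν s) (φ s) (a s) (b s))

include hφ hν

theorem tsum_condTypical_mul_measure_hashVector_eq_le (μ : Measure (∀ s, Z s)) (T T' : Finset S)
    (B : Finset T → ℝ≥0∞) (z' : ∀ s : T', Z s) (w : ∀ s : T, Z s) :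
    ∑' w', (condTypical μ T T' B z').indicator (condWeight μ T T' z') w' * Measure.pi ν
        {h | hashVector T (fun s => φ s (h s)) w' = hashVector T (fun s => φ s (h s)) w} ≤
      ∑ O : Finset T, (∏ s ∈ Oᶜ, a s / (Fintype.card (Γ s) : ℝ≥0∞)) *
        ((∏ s ∈ O, (1 + b s)) * B O) := by
  choose E _ ha hb using hν
  simp_rw [pi_setOf_hashVector_eq ν hφ]
  refine tsum_indicator_mul_prod_le_sum _ _
    (fun (s : T) x' => ν s {ω | φ s ω x' = φ s ω (w s)}) (fun s => insert (w s) (E s (w s)))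
    _ _ _ (fun s x' hx' => ?_) (fun s => ?_) fun O w hw => hw O
  · rw [Set.mem_insert_iff, not_or] at hx'
    exact ha s (w s) x' hx'.2 hx'.1
  · classical
    rw [ENNReal.tsum_eq_add_tsum_ite (w s), Set.indicator_of_mem (Set.mem_insert _ _)]
    refine add_le_add prob_le_one ((ENNReal.tsum_le_tsum fun x' => ?_).trans (hb s (w s)))
    split_ifs with h
    · exact zero_le
    · simp [Set.indicator_apply, h]

variable [∀ s, Nonempty (Γ s)] [∀ s, Countable (Z s)] [∀ s, MeasurableSingletonClass (Z s)]

theorem four_mul_lintegral_tsum_mul_one_sub_fiberDensity_condWeight_le (μ : Measure (∀ s, Z s))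
    [IsProbabilityMeasure μ] (T T' : Finset S) (B : Finset T → ℝ≥0∞) {η : ℝ≥0∞} (hη : η ≠ ∞) :
    4 * η * ∫⁻ h, ∑' z, μ {z} * (1 - fiberDensity (condWeight μ T T' (T'.restrict z))
        (hashVector T fun s => φ s (h s)) (T.restrict z)) ∂Measure.pi ν + 2 ≤
      4 * η ^ 2 + 1 + secondMomentBound T Γ a b B +
        (2 + 4 * η) * μ {z | T.restrict z ∉ condTypical μ T T' B (T'.restrict z)} := by
  let ψ (z' : ∀ s : T', Z s) (w : ∀ s : T, Z s) (h : ∀ s, Ω s) : ℝ≥0∞ :=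
    1 - fiberDensity (condWeight μ T T' z') (hashVector T fun s => φ s (h s)) w
  let d (z' : ∀ s : T', Z s) : ℝ≥0∞ := ∫⁻ h, ∑' w, condWeight μ T T' z' w * ψ z' w h ∂Measure.pi ν
  have hmean : ∫⁻ h, ∑' z, μ {z} * ψ (T'.restrict z) (T.restrict z) h ∂Measure.pi ν =
      ∑' z, μ {z} * d (T'.restrict z) := by
    have hψ : ∀ z', Measurable fun h => ∑' w, condWeight μ T T' z' w * ψ z' w h := fun z' =>
      Measurable.tsum fun w => ((measurable_fiberDensity (q := fun _ => condWeight μ T T' z')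
        (fun _ => measurable_const) (measurableSet_setOf_hashVector_eq hφ T) w).const_sub 1
          ).const_mul _
    simp_rw [← fun h => tsum_mul_tsum_condWeight_mul μ T T' fun z' w => ψ z' w h]
    rw [lintegral_tsum fun z => ((hψ _).const_mul _).aemeasurable]
    exact tsum_congr fun z => lintegral_const_mul _ (hψ _)
  have hone : ∑' z, μ {z} = 1 := (tsum_measure_singleton μ).trans measure_univ
  have hatypical := tsum_mul_tsum_indicator_condWeight μ T T' fun z' => (condTypical μ T T' B z')ᶜ
  simp only [Set.mem_compl_iff] at hatypical
  rw [hmean, ← hatypical]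
  calc 4 * η * ∑' z, μ {z} * d (T'.restrict z) + 2
      = ∑' z, μ {z} * (4 * η * d (T'.restrict z) + 2) := by
        simp_rw [mul_add, ENNReal.tsum_add, mul_left_comm _ (4 * η), ENNReal.tsum_mul_left,
          ENNReal.tsum_mul_right, hone, one_mul]
    _ ≤ ∑' z, μ {z} * (4 * η ^ 2 + 1 + secondMomentBound T Γ a b B +
          (2 + 4 * η) * ∑' w, (condTypical μ T T' B (T'.restrict z))ᶜ.indicator
            (condWeight μ T T' (T'.restrict z)) w) := by
        refine ENNReal.tsum_le_tsum fun z => ?_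
        by_cases hz : μ {z} = 0
        · simp [hz]
        exact mul_le_mul' le_rfl (four_mul_lintegral_tsum_mul_one_sub_fiberDensity_le _
          (measurableSet_setOf_hashVector_eq hφ T) (tsum_condWeight_eq_one μ _ _ hz) _ hη
          (tsum_condTypical_mul_measure_hashVector_eq_le hφ hν μ T T' B _))
    _ = _ := by
        simp_rw [mul_add (μ _), ENNReal.tsum_add, mul_left_comm _ (2 + 4 * η),
          ENNReal.tsum_mul_left, ENNReal.tsum_mul_right, hone, one_mul]

theorem lintegral_tsum_mul_one_sub_fiberDensity_condWeight_le (μ : Measure (∀ s, Z s))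
    [IsProbabilityMeasure μ] (T T' : Finset S) (B : Finset T → ℝ≥0∞) :
    ∫⁻ h, ∑' z, μ {z} * (1 - fiberDensity (condWeight μ T T' (T'.restrict z))
        (hashVector T fun s => φ s (h s)) (T.restrict z)) ∂Measure.pi ν ≤
      deficitBound μ T T' Γ a b B := by
  refine le_add_rpow_of_forall_four_mul_le ?_ fun η hη =>
    four_mul_lintegral_tsum_mul_one_sub_fiberDensity_condWeight_le hφ hν μ T T' B hη
  refine ne_top_of_le_ne_top ENNReal.one_ne_top
    ((lintegral_mono fun h => ENNReal.tsum_le_tsum fun z => mul_le_of_le_one_right' tsub_le_self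
      : _ ≤ ∫⁻ _, ∑' z, μ {z} ∂Measure.pi ν).trans ?_)
  rw [lintegral_const, measure_univ, mul_one, tsum_measure_singleton, measure_univ]

end EncoderAverage

/-! ### Decoding by sampling from the posterior law -/

section ExistsNe

theorem tsum_indicator_exists_ne_prod_le {J : Type*} [Fintype J] {α : J → Type*}
    (p : ∀ j, PMF (α j)) (x : ∀ j, α j) :
    ∑' d, {d : ∀ j, α j | ∃ j, d j ≠ x j}.indicator (fun d => ∏ j, p j (d j)) d ≤
      ∑ j, (1 - p j (x j)) := by
  classical
  have hcompl : ∀ j, ∑' y, ({x j}ᶜ : Set (α j)).indicator (p j) y ≤ 1 - p j (x j) := fun j => by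
    refine ENNReal.le_sub_of_add_le_left (PMF.apply_ne_top _ _) ?_
    rw [← (p j).toOuterMeasure_apply_singleton, PMF.toOuterMeasure_apply, ← ENNReal.tsum_add]
    simp_rw [Set.indicator_self_add_compl_apply]
    exact (PMF.tsum_coe _).le
  let p' (j k : J) : α k → ℝ≥0∞ := if k = j then ({x k}ᶜ : Set (α k)).indicator (p k) else p k
  have hp' : ∀ j k, k ≠ j → ∑' y, p' j k y ≤ 1 := fun j k hk => by
    simp only [p', if_neg hk, PMF.tsum_coe, le_refl]
  calc ∑' d, {d : ∀ j, α j | ∃ j, d j ≠ x j}.indicator (fun d => ∏ j, p j (d j)) d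
      ≤ ∑' d : ∀ j, α j, ∑ j, ∏ k, p' j k (d k) := by
        refine ENNReal.tsum_le_tsum fun d => Set.indicator_apply_le' ?_ fun _ => zero_le
        rintro ⟨j, hj⟩
        refine le_trans (le_of_eq (Finset.prod_congr rfl fun k _ => ?_))
          (Finset.single_le_sum (f := fun j => ∏ k, p' j k (d k)) (fun _ _ => zero_le)
            (Finset.mem_univ j))
        by_cases h : k = j
        · subst h
          simp [p', hj]
        · simp [p', h]
    _ = ∑ j, ∑' d : ∀ j, α j, ∏ k, p' j k (d k) :=
        Summable.tsum_finsetSum fun _ _ => ENNReal.summable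
    _ ≤ ∑ j, (1 - p j (x j)) := by
        refine Finset.sum_le_sum fun j _ => (tsum_pi_prod_le _).trans ?_
        rw [← Finset.mul_prod_erase _ _ (Finset.mem_univ j)]
        refine (mul_le_of_le_one_right zero_le (Finset.prod_le_one' fun k hk =>
          hp' j k (Finset.ne_of_mem_erase hk))).trans ?_
        simpa only [p', if_true] using hcompl j

theorem le_map_apply {α β : Type*} (p : PMF α) (φ : α → β) (x : α) : p x ≤ p.map φ (φ x) := by
  classical
  rw [PMF.map_apply]
  exact (if_pos rfl).ge.trans (ENNReal.le_tsum x)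

end ExistsNe

section Posterior

variable {H Ω B α Γ : Type*} [MeasurableSpace H] [MeasurableSpace Ω] [MeasurableSpace B]
  [MeasurableSpace α] [Countable α] [MeasurableSingletonClass α] [Nonempty α]
  {P : Measure Ω} [IsProbabilityMeasure P] {U : Ω → α} {V : Ω → B}
  (hU : Measurable U) (hV : Measurable V)

include hU hV

theorem lintegral_missProb_condDistrib (φ : α → Γ) :
    ∫⁻ ω, missProb (fun x => condDistrib U V P (V ω) {x}) φ (U ω) ∂P =
      ∫⁻ y, ∑' x, condDistrib U V P y {x} *
        missProb (fun x => condDistrib U V P y {x}) φ x ∂P.map V := by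
  have hmeas : Measurable fun p : B × α =>
      missProb (fun x => condDistrib U V P p.1 {x}) φ p.2 :=
    measurable_from_prod_countable_left fun x => measurable_missProb (Φ := fun _ => φ)
      (fun x => Kernel.measurable_coe _ (measurableSet_singleton x))
      (fun _ _ => MeasurableSet.const _) x
  rw [← lintegral_map (g := fun ω => (V ω, U ω)) hmeas (hV.prodMk hU),
    ← compProd_map_condDistrib hU.aemeasurable, Measure.lintegral_compProd hmeas]
  simp_rw [lintegral_countable', mul_comm]

omit [Nonempty α] hU hV in
theorem measurable_tsum_mul_missProb (κ : Kernel B α) {Φ : H → α → Γ}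
    (hΦ : ∀ x x', MeasurableSet {h | Φ h x' = Φ h x}) :
    Measurable fun p : H × B => ∑' x, κ p.2 {x} * missProb (fun x => κ p.2 {x}) (Φ p.1) x := by
  have hκ : ∀ x, Measurable fun p : H × B => κ p.2 {x} := fun x =>
    (Kernel.measurable_coe _ (measurableSet_singleton x)).comp measurable_snd
  exact Measurable.tsum fun x => (hκ x).mul <|
    measurable_missProb (H := H × B) hκ (fun x x' => measurable_fst (hΦ x x')) x

theorem measurable_lintegral_missProb_condDistrib {Φ : H → α → Γ}
    (hΦ : ∀ x x', MeasurableSet {h | Φ h x' = Φ h x}) :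
    Measurable fun h => ∫⁻ ω, missProb (fun x => condDistrib U V P (V ω) {x}) (Φ h) (U ω) ∂P := by
  simp_rw [lintegral_missProb_condDistrib hU hV]
  exact (measurable_tsum_mul_missProb _ hΦ).lintegral_prod_right'

theorem lintegral_lintegral_missProb_condDistrib_le (ν : Measure H) [IsProbabilityMeasure ν]
    {Φ : H → α → Γ} (hΦ : ∀ x x', MeasurableSet {h | Φ h x' = Φ h x}) {T : Set (B × α)}
    (hT : MeasurableSet T) {b : ℝ≥0∞} (hb : ∀ y x, (y, x) ∈ T →
      ν {h | ∃ x', (y, x') ∈ T ∧ x' ≠ x ∧ Φ h x' = Φ h x} ≤ b) :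
    ∫⁻ h, ∫⁻ ω, missProb (fun x => condDistrib U V P (V ω) {x}) (Φ h) (U ω) ∂P ∂ν ≤
      2 * P {ω | (V ω, U ω) ∉ T} + b := by
  set κ := condDistrib U V P with hκ
  have : IsProbabilityMeasure (P.map V) := Measure.isProbabilityMeasure_map hV.aemeasurable
  calc ∫⁻ h, ∫⁻ ω, missProb (fun x => κ (V ω) {x}) (Φ h) (U ω) ∂P ∂ν
      = ∫⁻ y, ∫⁻ h, ∑' x, κ y {x} * missProb (fun x => κ y {x}) (Φ h) x ∂ν ∂P.map V := by
        simp_rw [hκ, lintegral_missProb_condDistrib hU hV]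
        exact lintegral_lintegral_swap (measurable_tsum_mul_missProb _ hΦ).aemeasurable
    _ ≤ ∫⁻ y, (2 * κ y (Prod.mk y ⁻¹' Tᶜ) + b) ∂P.map V := by
        refine lintegral_mono fun y => ?_
        rw [← Measure.tsum_indicator_apply_singleton (κ y) _ (measurable_prodMk_left hT.compl)]
        exact lintegral_tsum_mul_missProb_le ν hΦ ((tsum_measure_singleton _).trans measure_univ)
          {x | (y, x) ∈ T} (hb y)
    _ = 2 * P {ω | (V ω, U ω) ∉ T} + b := by
        rw [lintegral_add_right _ measurable_const, lintegral_const_mul _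
          (Kernel.measurable_kernel_prodMk_left hT.compl), ← Measure.compProd_apply hT.compl,
          compProd_map_condDistrib hU.aemeasurable, Measure.map_apply (hV.prodMk hU) hT.compl,
          lintegral_const, measure_univ, mul_one]
        rfl

end Posterior

section CollisionBound

variable {S : Type*} {Z Ω Γ : S → Type*} [∀ s, Fintype (Γ s)]

/-- A bound, for hash functions with values in `Γ s`, on the probability that a vector has the same
hash values as some other typical vector, if at most `N O` typical vectors differ from it in the
coordinates in `O` only. -/
def collisionBound (D : Finset S) (Γ : S → Type*) [∀ s, Fintype (Γ s)] (a b : S → ℝ≥0∞)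
    (N : Finset D → ℝ≥0∞) : ℝ≥0∞ :=
  ∑ s : D, b s +
    ∑ O : Finset D with O.Nonempty, N O * ∏ s ∈ O, a s / (Fintype.card (Γ s) : ℝ≥0∞)

variable [Fintype S] [∀ s, Countable (Z s)] [∀ s, MeasurableSpace (Ω s)]
  {φ : ∀ s, Ω s → Z s → Γ s}

theorem measure_pi_exists_hashVector_eq_le
    (hφ : ∀ s x x', MeasurableSet {ω | φ s ω x' = φ s ω x}) {ν : ∀ s, Measure (Ω s)}
    [∀ s, IsProbabilityMeasure (ν s)] {a b : S → ℝ≥0∞}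
    (hν : ∀ s, IsAlmostUniversal (ν s) (φ s) (a s) (b s)) (D : Finset S)
    (T : Set (∀ s : D, Z s)) (N : Finset D → ℝ≥0∞) (w : ∀ s : D, Z s)
    (hN : ∀ O : Finset D, O.Nonempty → ({w' ∈ T | ∀ s ∉ O, w' s = w s}.encard : ℝ≥0∞) ≤ N O) :
    Measure.pi ν {h | ∃ w' ∈ T, w' ≠ w ∧
        hashVector D (fun s => φ s (h s)) w' = hashVector D (fun s => φ s (h s)) w} ≤
      collisionBound D Γ a b N := by
  choose E _ ha hb using hν
  let coll (w' : ∀ s : D, Z s) : Set (∀ s, Ω s) :=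
    {h | hashVector D (fun s => φ s (h s)) w' = hashVector D (fun s => φ s (h s)) w}
  let coll₁ (s : D) (x : Z s) : Set (∀ s, Ω s) :=
    Function.eval (s : S) ⁻¹' {ω | φ s ω x = φ s ω (w s)}
  let R : Set (∀ s : D, Z s) := {w' | w' ∈ T ∧ w' ≠ w ∧ ∀ s : D, w' s ∉ E s (w s)}
  have hunion : {h | ∃ w' ∈ T, w' ≠ w ∧ hashVector D (fun s => φ s (h s)) w' =
      hashVector D (fun s => φ s (h s)) w} ⊆
      (⋃ s : D, ⋃ x ∈ E s (w s), coll₁ s x) ∪ ⋃ w' ∈ R, coll w' := by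
    rintro h ⟨w', hT, hne, heq⟩
    by_cases hE : ∀ s : D, w' s ∉ E s (w s)
    · exact Or.inr (Set.mem_biUnion (show w' ∈ R from ⟨hT, hne, hE⟩) heq)
    · push Not at hE
      obtain ⟨s, hs⟩ := hE
      exact Or.inl (Set.mem_iUnion.2 ⟨s, Set.mem_biUnion hs (congrFun heq s)⟩)
  refine (measure_mono hunion).trans ((measure_union_le _ _).trans (add_le_add ?_ ?_))
  · refine (measure_iUnion_fintype_le _ _).trans (Finset.sum_le_sum fun s _ => ?_)
    refine (measure_biUnion_le _ (Set.to_countable _) _).trans (le_trans (le_of_eq ?_) (hb s (w s)))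
    rw [tsum_subtype (E s (w s)) fun x => Measure.pi ν (coll₁ s x)]
    simp_rw [coll₁, (measurePreserving_eval ν (s : S)).measure_preimage
      (hφ s (w s) _).nullMeasurableSet]
  · refine (measure_biUnion_le _ (Set.to_countable _) _).trans ?_
    rw [tsum_subtype R fun w' => Measure.pi ν (coll w')]
    simp_rw [coll, pi_setOf_hashVector_eq ν hφ]
    exact tsum_indicator_ne_prod_le_sum w T (fun s x => ν s {ω | φ s ω x = φ s ω (w s)})
      (fun s => E s (w s)) _ N (fun _ _ => prob_le_one) (fun s => ha s (w s)) hN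

end CollisionBound

section Mismatch

variable {S : Type*} {Z C M : S → Type*} [∀ s, MeasurableSpace (Z s)] [∀ s, Countable (Z s)]
  [∀ s, MeasurableSingletonClass (Z s)]

theorem one_sub_decoderOutput_le {B : Type*} [MeasurableSpace B] (D : Finset S)
    (κ : Kernel B (∀ s : D, Z s)) [IsMarkovKernel κ] (f : ∀ s, Z s → C s) (g : ∀ s, Z s → M s)
    (z : ∀ s, Z s) (y : B) :
    1 - decoderOutput D κ f g (D.restrict fun s => f s (z s)) y
        (some (D.restrict fun s => g s (z s))) ≤
      missProb (fun w => κ y {w}) (hashVector D f) (D.restrict z) := by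
  refine tsub_le_tsub_left (le_trans ?_ (le_map_apply _ _ (some (D.restrict z)))) 1
  rw [fiber_eq_preimage_hashVector]
  refine div_fiberMass_le_constrainedGenerator _ ?_ _ _
  rw [tsum_measure_singleton]
  exact measure_ne_top _ _

variable {I J : Type*} [Fintype S] [Fintype I] [DecidableEq S] [DecidableEq I] {X : I → Type*}
  {Y : J → Type*} [∀ i, MeasurableSpace (X i)] [∀ j, MeasurableSpace (Y j)] (A : Finset (S × I))
  (D : J → Finset S) (μ : Measure (∀ s, Z s)) (W : ∀ i, Kernel (∀ s : messagesOf A i, Z s) (X i))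
  [∀ i, IsMarkovKernel (W i)] (V : Kernel (∀ i, X i) (∀ j, Y j)) [IsMarkovKernel V]

theorem lintegral_jointLaw {φ : (∀ s, Z s) × (∀ i, X i) × (∀ j, Y j) → ℝ≥0∞} (hφ : Measurable φ) :
    ∫⁻ ω, φ ω ∂jointLaw A μ W V =
      ∑' z, μ {z} * ∫⁻ x, ∫⁻ y, φ (z, x, y) ∂V x ∂inputKernel A W z := by
  rw [jointLaw, Measure.lintegral_compProd hφ, lintegral_countable']
  refine tsum_congr fun z => ?_
  rw [mul_comm, Kernel.lintegral_compProd (f := fun b => φ (z, b)) _ _ _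
    (hφ.comp measurable_prodMk_left)]
  rfl

variable [IsProbabilityMeasure μ] [∀ s, Nonempty (Z s)]

instance (j : J) : IsMarkovKernel (posterior A D μ W V j) := by
  unfold posterior
  infer_instance

variable [Fintype J] (f : ∀ s, Z s → C s) (g : ∀ s, Z s → M s)

theorem mismatchProb_eq_tsum_indicator (c : ∀ s, C s) (m : ∀ s, M s) (y : ∀ j, Y j) :
    mismatchProb A D μ W V f g c m y =
      ∑' d, {d : ∀ j, Option (∀ s : D j, M s) | ∃ j, d j ≠ some ((D j).restrict m)}.indicator
        (fun d => ∏ j, decoderOutput (D j) (posterior A D μ W V j) f g ((D j).restrict c) (y j)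
          (d j)) d := by
  classical
  simp only [mismatchProb, Set.indicator_apply, Set.mem_ofPred_eq]

theorem mismatchProb_le_one (c : ∀ s, C s) (m : ∀ s, M s) (y : ∀ j, Y j) :
    mismatchProb A D μ W V f g c m y ≤ 1 := by
  rw [mismatchProb_eq_tsum_indicator]
  refine (ENNReal.tsum_le_tsum fun d => Set.indicator_le_self _ _ _).trans
    ((tsum_pi_prod_le fun j => decoderOutput (D j) (posterior A D μ W V j) f g
      ((D j).restrict c) (y j)).trans ?_)
  exact Finset.prod_le_one' fun j _ => (PMF.tsum_coe _).le

theorem mismatchProb_le_sum_missProb (z : ∀ s, Z s) (y : ∀ j, Y j) :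
    mismatchProb A D μ W V f g (fun s => f s (z s)) (fun s => g s (z s)) y ≤
      ∑ j, missProb (fun w => posterior A D μ W V j (y j) {w}) (hashVector (D j) f)
        ((D j).restrict z) := by
  rw [mismatchProb_eq_tsum_indicator]
  exact (tsum_indicator_exists_ne_prod_le (fun j => decoderOutput (D j) (posterior A D μ W V j) f g
    ((D j).restrict fun s => f s (z s)) (y j)) fun j => some ((D j).restrict fun s =>
      g s (z s))).trans (Finset.sum_le_sum fun j _ => one_sub_decoderOutput_le (D j) _ f g z (y j))

theorem tsum_mul_lintegral_mismatchProb_le :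
    ∑' z, μ {z} * ∫⁻ x, ∫⁻ y, mismatchProb A D μ W V f g (fun s => f s (z s))
        (fun s => g s (z s)) y ∂V x ∂inputKernel A W z ≤
      ∑ j, ∫⁻ ω, missProb (fun w => posterior A D μ W V j (ω.2.2 j) {w}) (hashVector (D j) f)
        ((D j).restrict ω.1) ∂jointLaw A μ W V := by
  have hmeas : ∀ j, Measurable fun ω : (∀ s, Z s) × (∀ i, X i) × (∀ j, Y j) =>
      missProb (fun w => posterior A D μ W V j (ω.2.2 j) {w}) (hashVector (D j) f)
        ((D j).restrict ω.1) := fun j => by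
    refine measurable_from_prod_countable_right fun z => ?_
    change Measurable fun y : (∀ i, X i) × (∀ j, Y j) => missProb
      (fun w => posterior A D μ W V j (y.2 j) {w}) (hashVector (D j) f) ((D j).restrict z)
    exact measurable_missProb (H := (∀ i, X i) × (∀ j, Y j))
      (q := fun ω w => posterior A D μ W V j (ω.2 j) {w}) (Φ := fun _ => hashVector (D j) f)
      (fun w => (Kernel.measurable_coe _ (measurableSet_singleton w)).comp
        ((measurable_pi_apply j).comp measurable_snd)) (fun _ _ => MeasurableSet.const _) _
  rw [← lintegral_finsetSum _ fun j _ => hmeas j,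
    lintegral_jointLaw A μ W V (Finset.measurable_sum _ fun j _ => hmeas j)]
  exact ENNReal.tsum_le_tsum fun z => mul_le_mul' le_rfl (lintegral_mono fun x =>
    lintegral_mono fun y => mismatchProb_le_sum_missProb A D μ W V f g z y)

end Mismatch

section RandomCoding

theorem measurableSet_fst_apply_eq {α γ γ' : Type*} [Countable γ] [MeasurableSpace γ]
    [MeasurableSingletonClass γ] [MeasurableSpace γ'] (x x' : α) :
    MeasurableSet {p : (α → γ) × (α → γ') | p.1 x' = p.1 x} :=
  measurableSet_eq_fun (by fun_prop) (by fun_prop)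

variable {S : Type*} [Fintype S] {Z C M : S → Type*}

section CodeLaw

variable [∀ s, MeasurableSpace (C s)] [∀ s, MeasurableSpace (M s)]

/-- The law of independent random functions `f_s` and `g_s`, `s ∈ S`. -/
def codeLaw (F : ∀ s, Ensemble (Z s) (C s)) (G : ∀ s, Ensemble (Z s) (M s)) :
    Measure (∀ s, (Z s → C s) × (Z s → M s)) :=
  Measure.pi fun s => (F s).law.prod (G s).law

instance (F : ∀ s, Ensemble (Z s) (C s)) (G : ∀ s, Ensemble (Z s) (M s)) :
    IsProbabilityMeasure (codeLaw F G) := by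
  unfold codeLaw
  infer_instance

theorem ae_mem_funs (F : ∀ s, Ensemble (Z s) (C s)) (G : ∀ s, Ensemble (Z s) (M s)) :
    ∀ᵐ h ∂codeLaw F G, ∀ s, (h s).1 ∈ (F s).funs ∧ (h s).2 ∈ (G s).funs :=
  ae_all_iff.2 fun s => (Measure.quasiMeasurePreserving_eval
    (fun s => (F s).law.prod (G s).law) s).ae <|
    (Measure.quasiMeasurePreserving_fst.ae (F s).ae_mem).and
      (Measure.quasiMeasurePreserving_snd.ae (G s).ae_mem)

end CodeLaw

variable [∀ s, MeasurableSpace (Z s)] [∀ s, Countable (Z s)] [∀ s, MeasurableSingletonClass (Z s)]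
  {I J : Type*} [Fintype I] [DecidableEq S] [DecidableEq I] {X : I → Type*} {Y : J → Type*}
  [∀ i, MeasurableSpace (X i)] [∀ j, MeasurableSpace (Y j)]
  (A : Finset (S × I)) (D : J → Finset S) (μ : Measure (∀ s, Z s)) [IsProbabilityMeasure μ]
  (W : ∀ i, Kernel (∀ s : messagesOf A i, Z s) (X i)) [∀ i, IsMarkovKernel (W i)]
  (V : Kernel (∀ i, X i) (∀ j, Y j)) [IsMarkovKernel V]

section Mean

variable [∀ s, MeasurableSpace (C s)] [∀ s, MeasurableSingletonClass (C s)]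
  [∀ s, MeasurableSpace (M s)] {F : ∀ s, Ensemble (Z s) (C s)} {G : ∀ s, Ensemble (Z s) (M s)}
  {a b a' b' : S → ℝ≥0}

section Decoders

variable [∀ s, Nonempty (Z s)]

theorem measurable_lintegral_missProb_posterior [∀ s, Countable (C s)] (j : J) :
    Measurable fun h : ∀ s, (Z s → C s) × (Z s → M s) =>
      ∫⁻ ω, missProb (fun w => posterior A D μ W V j (ω.2.2 j) {w})
        (hashVector (D j) fun s => (h s).1) ((D j).restrict ω.1) ∂jointLaw A μ W V :=
  measurable_lintegral_missProb_condDistrib ((Finset.measurable_restrict _).comp measurable_fst)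
    (by fun_prop) (measurableSet_setOf_hashVector_eq (fun _ => measurableSet_fst_apply_eq) (D j))

theorem lintegral_codeLaw_missProb_posterior_le [∀ s, Fintype (C s)]
    (hF : ∀ s, (F s).IsHash (a s) (b s))
    (hFim : ∀ s, (F s).im = Set.univ) (j : J) {T : Set (Y j × (∀ s : D j, Z s))}
    (hT : MeasurableSet T) {N : Finset (D j) → ℝ≥0∞}
    (hN : ∀ y (w : ∀ s : D j, Z s), ∀ O : Finset (D j), O.Nonempty →
      ({w' | (y, w') ∈ T ∧ ∀ s ∉ O, w' s = w s}.encard : ℝ≥0∞) ≤ N O) :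
    ∫⁻ h, ∫⁻ ω, missProb (fun w => posterior A D μ W V j (ω.2.2 j) {w})
        (hashVector (D j) fun s => (h s).1) ((D j).restrict ω.1) ∂jointLaw A μ W V ∂codeLaw F G ≤
      2 * jointLaw A μ W V {ω | (ω.2.2 j, (D j).restrict ω.1) ∉ T} +
        collisionBound (D j) C (fun s => a s) (fun s => b s) N := by
  have hφ (s : S) := measurableSet_fst_apply_eq (α := Z s) (γ := C s) (γ' := M s)
  exact lintegral_lintegral_missProb_condDistrib_le
    ((Finset.measurable_restrict _).comp measurable_fst) (by fun_prop) (codeLaw F G)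
    (measurableSet_setOf_hashVector_eq hφ (D j)) hT fun y w _ =>
      measure_pi_exists_hashVector_eq_le hφ (fun s => ((hF s).isAlmostUniversal (hFim s)).comp_fst)
        (D j) {w | (y, w) ∈ T} N w fun O hO => hN y w O hO

end Decoders

section Encoders

variable [∀ s, Fintype (C s)] [∀ s, Fintype (M s)] [∀ s, MeasurableSingletonClass (M s)]

omit [∀ s, MeasurableSingletonClass (Z s)] [IsProbabilityMeasure μ] in
theorem measurable_stepDensity (I' : Finset I) (z : ∀ s, Z s) :
    Measurable fun h : ∀ s, (Z s → C s) × (Z s → M s) =>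
      stepDensity A μ (fun s => (h s).1) (fun s => (h s).2) I' z :=
  measurable_fiberDensity (q := fun _ => condWeight μ _ _ _) (fun _ => measurable_const)
    (measurableSet_setOf_hashVector_eq
      (φ := fun s (p : (Z s → C s) × (Z s → M s)) x => (p.1 x, p.2 x))
      (fun s x x' => measurableSet_eq_fun (by fun_prop) (by fun_prop)) _) _

variable [∀ s, Nonempty (C s)] [∀ s, Nonempty (M s)]

theorem lintegral_codeLaw_one_sub_stepDensity_le (hF : ∀ s, (F s).IsHash (a s) (b s))
    (hFim : ∀ s, (F s).im = Set.univ) (hG : ∀ s, (G s).IsHash (a' s) (b' s))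
    (hGim : ∀ s, (G s).im = Set.univ) (I' : Finset I)
    (B : Finset (privateMessages A I') → ℝ≥0∞) :
    ∫⁻ h, ∑' z, μ {z} * (1 - stepDensity A μ (fun s => (h s).1) (fun s => (h s).2) I' z)
        ∂codeLaw F G ≤
      deficitBound μ (privateMessages A I') (publicMessages A I') (fun s => C s × M s)
        (fun s => a s * a' s) (fun s => b s + b' s) B :=
  lintegral_tsum_mul_one_sub_fiberDensity_condWeight_le
    (φ := fun s (p : (Z s → C s) × (Z s → M s)) x => (p.1 x, p.2 x))
    (fun s x x' => measurableSet_eq_fun (by fun_prop) (by fun_prop))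
    (fun s => ((hF s).isAlmostUniversal (hFim s)).prodMk ((hG s).isAlmostUniversal (hGim s)))
    μ _ _ B

end Encoders

end Mean

variable [Fintype J] [∀ s, Nonempty (Z s)] [∀ s, Fintype (C s)] [∀ s, Nonempty (C s)]
  [∀ s, Fintype (M s)] [∀ s, Nonempty (M s)]

theorem sum_prod_inv_card_mul_errorProb_le (L : List (Finset I))
    (hL : IsReverseLinearExtension A L) (hμ : IsConsistent A μ) (f : ∀ s, Z s → C s)
    (g : ∀ s, Z s → M s) :
    ∑ c : ∀ s, C s, (∏ s, (Fintype.card (C s) : ℝ≥0∞)⁻¹) * errorProb A L D μ W V f g c ≤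
      ∑ j, ∫⁻ ω, missProb (fun w => posterior A D μ W V j (ω.2.2 j) {w}) (hashVector (D j) f)
        ((D j).restrict ω.1) ∂jointLaw A μ W V +
      ∑ I' ∈ accessFamily A, ∑' z, μ {z} * (1 - stepDensity A μ f g I' z) := by
  let E (c : ∀ s, C s) (m : ∀ s, M s) (o : Option (∀ s, Z s)) : ℝ≥0∞ :=
    o.elim 1 fun z => ∫⁻ x, ∫⁻ y, mismatchProb A D μ W V f g c m y ∂V x ∂inputKernel A W z
  have hE : ∀ c m o, E c m o ≤ 1 := by
    rintro c m (_ | z)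
    · exact le_rfl
    · calc E c m (some z) ≤ ∫⁻ x, ∫⁻ _, 1 ∂V x ∂inputKernel A W z :=
            lintegral_mono fun x => lintegral_mono fun y => mismatchProb_le_one A D μ W V f g c m y
        _ = 1 := by simp
  have herr : ∀ c, errorProb A L D μ W V f g c =
      ∑ m : ∀ s, M s, (∏ s, (Fintype.card (M s) : ℝ≥0∞)⁻¹) *
        ∑' o, encoderRun A μ f g c m L (fun _ => Classical.arbitrary _) o * E c m o := fun c =>
    Finset.sum_congr rfl fun m _ => congrArg _ <| tsum_congr fun o => by cases o <;> rfl
  simp_rw [herr]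
  exact (sum_encoderRun_mul_le A L hL μ hμ f g _ E hE).trans <|
    add_le_add (tsum_mul_lintegral_mismatchProb_le A D μ W V f g) le_rfl

theorem exists_errorProb_le (L : List (Finset I)) (hL : IsReverseLinearExtension A L)
    (hμ : IsConsistent A μ) (f : ∀ s, Z s → C s) (g : ∀ s, Z s → M s) :
    ∃ c, errorProb A L D μ W V f g c ≤
      ∑ j, ∫⁻ ω, missProb (fun w => posterior A D μ W V j (ω.2.2 j) {w}) (hashVector (D j) f)
        ((D j).restrict ω.1) ∂jointLaw A μ W V +
      ∑ I' ∈ accessFamily A, ∑' z, μ {z} * (1 - stepDensity A μ f g I' z) := by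
  have hmean := sum_prod_inv_card_mul_errorProb_le A D μ W V L hL hμ f g
  by_contra! hlt
  have hweight : ∏ s, (Fintype.card (C s) : ℝ≥0∞)⁻¹ ≠ 0 :=
    Finset.prod_ne_zero_iff.2 fun s _ => by simp
  have hweight_top : ∏ s, (Fintype.card (C s) : ℝ≥0∞)⁻¹ ≠ ∞ :=
    ENNReal.prod_ne_top fun s _ => by simp
  refine absurd hmean (not_le.2 ?_)
  refine lt_of_eq_of_lt ?_ (ENNReal.sum_lt_sum_of_nonempty Finset.univ_nonempty fun c _ =>
    (ENNReal.mul_lt_mul_iff_right hweight hweight_top).2 (hlt c))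
  rw [← Finset.sum_mul, sum_prod_inv_card, one_mul]

variable [∀ s, MeasurableSpace (C s)] [∀ s, MeasurableSingletonClass (C s)]
  [∀ s, MeasurableSpace (M s)] [∀ s, MeasurableSingletonClass (M s)]
  {F : ∀ s, Ensemble (Z s) (C s)} {G : ∀ s, Ensemble (Z s) (M s)} {a b a' b' : S → ℝ≥0}

theorem exists_code_le (L : List (Finset I)) (hL : IsReverseLinearExtension A L)
    (hμ : IsConsistent A μ) (hF : ∀ s, (F s).IsHash (a s) (b s))
    (hFim : ∀ s, (F s).im = Set.univ) (hG : ∀ s, (G s).IsHash (a' s) (b' s))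
    (hGim : ∀ s, (G s).im = Set.univ) (T : ∀ j, Set (Y j × (∀ s : D j, Z s)))
    (hT : ∀ j, MeasurableSet (T j)) (N : ∀ j, Finset (D j) → ℝ≥0∞)
    (hN : ∀ j y (w : ∀ s : D j, Z s), ∀ O : Finset (D j), O.Nonempty →
      ({w' | (y, w') ∈ T j ∧ ∀ s ∉ O, w' s = w s}.encard : ℝ≥0∞) ≤ N j O)
    (B : ∀ I', Finset (privateMessages A I') → ℝ≥0∞) :
    ∃ (f : ∀ s, Z s → C s) (g : ∀ s, Z s → M s) (c : ∀ s, C s),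
      (∀ s, f s ∈ (F s).funs) ∧ (∀ s, g s ∈ (G s).funs) ∧
      errorProb A L D μ W V f g c ≤
        ∑ j, (2 * jointLaw A μ W V {ω | (ω.2.2 j, (D j).restrict ω.1) ∉ T j} +
          collisionBound (D j) C (fun s => a s) (fun s => b s) (N j)) +
        ∑ I' ∈ accessFamily A, deficitBound μ (privateMessages A I') (publicMessages A I')
          (fun s => C s × M s) (fun s => a s * a' s) (fun s => b s + b' s) (B I') := by
  let dec (j : J) (h : ∀ s, (Z s → C s) × (Z s → M s)) : ℝ≥0∞ :=
    ∫⁻ ω, missProb (fun w => posterior A D μ W V j (ω.2.2 j) {w})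
      (hashVector (D j) fun s => (h s).1) ((D j).restrict ω.1) ∂jointLaw A μ W V
  let enc (I' : Finset I) (h : ∀ s, (Z s → C s) × (Z s → M s)) : ℝ≥0∞ :=
    ∑' z, μ {z} * (1 - stepDensity A μ (fun s => (h s).1) (fun s => (h s).2) I' z)
  have hdec : ∀ j, Measurable (dec j) := measurable_lintegral_missProb_posterior A D μ W V
  have henc : ∀ I', Measurable (enc I') := fun I' =>
    Measurable.tsum fun z => ((measurable_stepDensity A μ I' z).const_sub 1).const_mul _
  obtain ⟨h, hmem, hmean⟩ := exists_notMem_null_le_lintegral (μ := codeLaw F G)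
    ((Finset.measurable_sum Finset.univ fun j _ => hdec j).add
      (Finset.measurable_sum (accessFamily A) fun I' _ => henc I')).aemeasurable (ae_mem_funs F G)
  obtain ⟨c, hc⟩ := exists_errorProb_le A D μ W V L hL hμ (fun s => (h s).1) fun s => (h s).2
  have hfuns := not_not.1 hmem
  refine ⟨_, _, c, fun s => (hfuns s).1, fun s => (hfuns s).2, hc.trans (hmean.trans ?_)⟩
  simp only [Pi.add_apply]
  rw [lintegral_add_left (Finset.measurable_sum _ fun j _ => hdec j),
    lintegral_finsetSum _ fun j _ => hdec j, lintegral_finsetSum _ fun I' _ => henc I']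
  exact add_le_add
    (Finset.sum_le_sum fun j _ =>
      lintegral_codeLaw_missProb_posterior_le A D μ W V hF hFim j (hT j) (hN j))
    (Finset.sum_le_sum fun I' _ =>
      lintegral_codeLaw_one_sub_stepDensity_le A μ hF hFim hG hGim I' (B I'))

end RandomCoding

/-! ### Typical vectors -/

section Likely

variable {Ω α β : Type*} [MeasurableSpace α] [Countable α] [MeasurableSingletonClass α]
  [MeasurableSpace β]

theorem encard_setOf_inv_le_measure_singleton_le (P : Measure α) [IsProbabilityMeasure P]
    (N : ℝ≥0∞) : ({x | N⁻¹ ≤ P {x}}.encard : ℝ≥0∞) ≤ N := by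
  have h := mul_meas_ge_le_lintegral (μ := Measure.count)
    (measurable_of_countable fun x => P {x}) N⁻¹
  rw [lintegral_count, tsum_measure_singleton, measure_univ,
    Measure.count_apply (Set.to_countable _).measurableSet, mul_comm,
    ← ENNReal.le_inv_iff_mul_le, inv_inv] at h
  exact h

theorem measurable_kernel_singleton (κ : Kernel β α) :
    Measurable fun t : β × α => κ t.1 {t.2} :=
  measurable_from_prod_countable_left fun x => Kernel.measurable_coe κ (measurableSet_singleton x)

variable [MeasurableSpace Ω] [Nonempty α] {P : Measure Ω} [IsFiniteMeasure P] {U : Ω → α}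
  {V : Ω → β} (hU : Measurable U) (hV : Measurable V)

include hU hV

theorem measure_condDistrib_singleton_eq_zero :
    P {ω | condDistrib U V P (V ω) {U ω} = 0} = 0 := by
  have hzero : MeasurableSet {t : β × α | condDistrib U V P t.1 {t.2} = 0} :=
    measurable_kernel_singleton _ (measurableSet_singleton 0)
  have hfiber (v : β) : condDistrib U V P v {u | condDistrib U V P v {u} = 0} = 0 :=
    (measure_null_iff_singleton (Set.to_countable _)).2 fun _ hu => hu
  calc P {ω | condDistrib U V P (V ω) {U ω} = 0}
      = P.map (fun ω => (V ω, U ω)) {t : β × α | condDistrib U V P t.1 {t.2} = 0} :=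
        (Measure.map_apply (hV.prodMk hU) hzero).symm
    _ = ∫⁻ v, condDistrib U V P v {u | condDistrib U V P v {u} = 0} ∂P.map V := by
        rw [← compProd_map_condDistrib hU.aemeasurable, Measure.compProd_apply hzero]
        rfl
    _ = 0 := by simp only [hfiber, lintegral_zero]

theorem condDistrib_apply_singleton [MeasurableSingletonClass β] {v : β} (hv : P (V ⁻¹' {v}) ≠ 0)
    (u : α) : condDistrib U V P v {u} = P {ω | U ω = u ∧ V ω = v} / P (V ⁻¹' {v}) := by
  have hmap : P.map V {v} = P (V ⁻¹' {v}) := Measure.map_apply hV (measurableSet_singleton v)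
  rw [condDistrib_apply_of_ne_zero hU v (hmap ▸ hv), hmap, ENNReal.div_eq_inv_mul,
    Measure.map_apply (hV.prodMk hU) ((measurableSet_singleton v).prod (measurableSet_singleton u))]
  congr 2
  ext ω
  exact and_comm

end Likely

section Typical

variable {S : Type*} {T : Finset S}

/-- The subset of `S` that corresponds to a subset of `T ⊆ S`. -/
def liftFinset (O : Finset T) : Finset S := O.map (Function.Embedding.subtype _)

theorem liftFinset_subset (O : Finset T) : liftFinset O ⊆ T := by
  intro s hs
  obtain ⟨t, -, rfl⟩ := Finset.mem_map.1 hs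
  exact t.2

theorem coe_mem_liftFinset {O : Finset T} {t : T} : (t : S) ∈ liftFinset O ↔ t ∈ O := by
  simp [liftFinset]

theorem sum_liftFinset (O : Finset T) (ρ : S → ℝ) : ∑ s ∈ liftFinset O, ρ s = ∑ t ∈ O, ρ t :=
  Finset.sum_map _ _ _

theorem restrict_liftFinset_eq_iff {Z : S → Type*} {O : Finset T} {z z' : ∀ s, Z s} :
    (liftFinset O).restrict z = (liftFinset O).restrict z' ↔
      O.restrict (T.restrict z) = O.restrict (T.restrict z') := by
  refine ⟨fun h => funext fun t => congrFun h ⟨t, coe_mem_liftFinset.2 t.2⟩, fun h => ?_⟩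
  exact funext fun ⟨s, hs⟩ =>
    congrFun h ⟨⟨s, liftFinset_subset O hs⟩, coe_mem_liftFinset.1 hs⟩

variable [Finite S] {Z : S → Type*} [∀ s, MeasurableSpace (Z s)] [∀ s, Countable (Z s)]
  [∀ s, MeasurableSingletonClass (Z s)]
  {Ω B : Type*} [MeasurableSpace Ω] [MeasurableSpace B]
  {P : Measure Ω} [IsProbabilityMeasure P] {ζ : Ω → ∀ s, Z s}

section Encoder

variable {μ : Measure (∀ s, Z s)}

theorem fiberMass_condWeight_empty_le_one (μ : Measure (∀ s, Z s)) (T T' : Finset S)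
    (z' : ∀ s : T', Z s) (a : ∀ s : (∅ : Finset T), Z s) :
    fiberMass (condWeight μ T T' z') (∅ : Finset T).restrict a ≤ 1 :=
  (fiberMass_le_tsum _ _ _).trans (tsum_condWeight_le_one μ T T' z')

variable [∀ s, Nonempty (Z s)]

theorem condDistrib_restrict_eq_fiberMass (hζ : MeasurePreserving ζ P μ) (T' : Finset S)
    (O : Finset T) {z : ∀ s, Z s} (hz : μ {x | T'.restrict x = T'.restrict z} ≠ 0) :
    condDistrib (fun ω => (liftFinset O).restrict (ζ ω)) (fun ω => T'.restrict (ζ ω)) P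
        (T'.restrict z) {(liftFinset O).restrict z} =
      fiberMass (condWeight μ T T' (T'.restrict z)) O.restrict (O.restrict (T.restrict z)) := by
  have hpre (E : Set (∀ s, Z s)) : P (ζ ⁻¹' E) = μ E :=
    hζ.measure_preimage (Set.to_countable E).measurableSet.nullMeasurableSet
  have hV : P ((fun ω => T'.restrict (ζ ω)) ⁻¹' {T'.restrict z}) =
      μ {x | T'.restrict x = T'.restrict z} := hpre {x | T'.restrict x = T'.restrict z}
  have hmeas (R : Finset S) : Measurable fun ω => R.restrict (ζ ω) :=
    (Finset.measurable_restrict R).comp hζ.measurable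
  rw [condDistrib_apply_singleton (hmeas _) (hmeas _) (hV ▸ hz), hV, fiberMass_condWeight]
  simp only [restrict_liftFinset_eq_iff]
  exact congrArg (· / _) (hpre {x | O.restrict (T.restrict x) = O.restrict (T.restrict z) ∧
    T'.restrict x = T'.restrict z})

theorem measure_notMem_condTypical_le (hζ : MeasurePreserving ζ P μ) (T T' : Finset S)
    {B : Finset T → ℝ≥0∞} (hB : 1 ≤ B ∅) :
    μ {z | T.restrict z ∉ condTypical μ T T' B (T'.restrict z)} ≤
      ∑ O : Finset T with O.Nonempty, P {ω | B O <
        condDistrib (fun ω => (liftFinset O).restrict (ζ ω)) (fun ω => T'.restrict (ζ ω)) P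
          (T'.restrict (ζ ω)) {(liftFinset O).restrict (ζ ω)}} := by
  rw [← hζ.measure_preimage (Set.to_countable _).measurableSet.nullMeasurableSet]
  refine (measure_mono fun ω hω => ?_).trans (measure_biUnion_finset_le _ _)
  obtain ⟨O, hO⟩ := not_forall.1 hω
  rw [not_le] at hO
  have hpos : μ {x | T'.restrict x = T'.restrict (ζ ω)} ≠ 0 := by
    intro h
    rw [fiberMass_condWeight, measure_mono_null (fun x hx => hx.2) h, ENNReal.zero_div] at hO
    exact not_lt_zero hO
  have hne : O.Nonempty := by
    rw [Finset.nonempty_iff_ne_empty]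
    rintro rfl
    exact hO.not_ge ((fiberMass_condWeight_empty_le_one μ T T' _ _).trans hB)
  refine Set.mem_biUnion (Finset.mem_filter.2 ⟨Finset.mem_univ O, hne⟩) ?_
  rwa [Set.mem_ofPred_eq, condDistrib_restrict_eq_fiberMass hζ T' O hpos]

end Encoder

section Decoder

variable [DecidableEq S] [∀ s, Nonempty (Z s)]

variable (P) in
/-- The conditional law of the part `O` of `ζ_D`, given `η` and the rest of `ζ_D`. -/
def partialPosterior (ζ : Ω → ∀ s, Z s) (η : Ω → B) (D : Finset S) (O : Finset D) :
    Kernel (B × (∀ s : (D \ liftFinset O : Finset S), Z s)) (∀ s : liftFinset O, Z s) :=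
  condDistrib (fun ω => (liftFinset O).restrict (ζ ω))
    (fun ω => (η ω, (D \ liftFinset O).restrict (ζ ω))) P

variable (P) in
/-- The pairs `(y, w)` such that every part `w_O` of `w` has conditional probability at least
`1 / N O`, given `y` and the rest of `w`. -/
def posteriorTypical (ζ : Ω → ∀ s, Z s) (η : Ω → B) (D : Finset S) (N : Finset D → ℝ≥0∞) :
    Set (B × (∀ s : D, Z s)) :=
  {t | ∀ O : Finset D, O.Nonempty → (N O)⁻¹ ≤ partialPosterior P ζ η D O
    (t.1, Finset.restrict₂ Finset.sdiff_subset t.2) {Finset.restrict₂ (liftFinset_subset O) t.2}}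

variable {η : Ω → B}

theorem measurableSet_posteriorTypical (D : Finset S) (N : Finset D → ℝ≥0∞) :
    MeasurableSet (posteriorTypical P ζ η D N) := by
  refine measurableSet_setOfPred.2 <| Measurable.forall fun O => Measurable.forall fun _ =>
    measurableSet_setOfPred.1 <| measurableSet_le measurable_const ?_
  exact (measurable_kernel_singleton (partialPosterior P ζ η D O)).comp <|
    (measurable_fst.prodMk ((Finset.measurable_restrict₂ _).comp measurable_snd)).prodMk
      ((Finset.measurable_restrict₂ (liftFinset_subset O)).comp measurable_snd)

theorem encard_posteriorTypical_le (D : Finset S) (N : Finset D → ℝ≥0∞) (y : B)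
    (w : ∀ s : D, Z s) {O : Finset D} (hO : O.Nonempty) :
    ({w' | (y, w') ∈ posteriorTypical P ζ η D N ∧ ∀ s ∉ O, w' s = w s}.encard : ℝ≥0∞) ≤ N O := by
  let w₀ : ∀ s : (D \ liftFinset O : Finset S), Z s := Finset.restrict₂ Finset.sdiff_subset w
  have : IsProbabilityMeasure (partialPosterior P ζ η D O (y, w₀)) := by
    unfold partialPosterior
    infer_instance
  refine le_trans ?_ (encard_setOf_inv_le_measure_singleton_le
    (partialPosterior P ζ η D O (y, w₀)) (N O))
  refine ENat.toENNReal_le.2 <| Set.encard_le_encard_of_injOn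
    (f := Finset.restrict₂ (π := Z) (liftFinset_subset O)) ?_ ?_
  · rintro w' ⟨hw', hagree⟩
    have hrest : Finset.restrict₂ (π := Z) (Finset.sdiff_subset (t := liftFinset O)) w' = w₀ :=
      funext fun ⟨s, hs⟩ => hagree ⟨s, (Finset.mem_sdiff.1 hs).1⟩ fun h =>
        (Finset.mem_sdiff.1 hs).2 (coe_mem_liftFinset.2 h)
    rw [Set.mem_ofPred_eq, ← hrest]
    exact hw' O hO
  · rintro w₁ ⟨-, h₁⟩ w₂ ⟨-, h₂⟩ h
    refine funext fun s => ?_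
    by_cases hs : s ∈ O
    · exact congrFun h ⟨s, coe_mem_liftFinset.2 hs⟩
    · exact (h₁ s hs).trans (h₂ s hs).symm

theorem measure_notMem_posteriorTypical_le (D : Finset S) (N : Finset D → ℝ≥0∞) :
    P {ω | (η ω, D.restrict (ζ ω)) ∉ posteriorTypical P ζ η D N} ≤
      ∑ O : Finset D with O.Nonempty, P {ω |
        condDistrib (fun ω => (liftFinset O).restrict (ζ ω))
          (fun ω => (η ω, (D \ liftFinset O).restrict (ζ ω))) P
          (η ω, (D \ liftFinset O).restrict (ζ ω)) {(liftFinset O).restrict (ζ ω)} < (N O)⁻¹} := by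
  refine (measure_mono fun ω hω => ?_).trans (measure_biUnion_finset_le _ _)
  simp only [posteriorTypical, Set.mem_ofPred_eq, not_forall, not_le] at hω
  obtain ⟨O, hO, hlt⟩ := hω
  exact Set.mem_biUnion (Finset.mem_filter.2 ⟨Finset.mem_univ O, hO⟩) hlt

end Decoder

end Typical

/-! ### Exponential rates -/

section Rates

/-- The exponential growth rate of `k n`: up to a subexponential factor, `k n` is `2 ^ (n * ρ)`. -/
def HasRate (k : ℕ → ℕ) (ρ : ℝ) : Prop :=
  Tendsto (fun n : ℕ => Real.logb 2 (k n) / n) atTop (𝓝 ρ)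

theorem two_rpow_logb_toReal {p : ℝ≥0∞} (hp : p ≠ 0) (hp' : p ≠ ∞) :
    (2 : ℝ≥0∞) ^ Real.logb 2 p.toReal = p := by
  rw [← ENNReal.ofReal_ofNat, ENNReal.ofReal_rpow_of_pos two_pos,
    Real.rpow_logb two_pos (by norm_num) (ENNReal.toReal_pos hp hp'), ENNReal.ofReal_toReal hp']

theorem tendsto_two_rpow_mul_of_neg {x : ℕ → ℝ} {l : ℝ} (hx : Tendsto x atTop (𝓝 l)) (hl : l < 0) :
    Tendsto (fun n : ℕ => (2 : ℝ≥0∞) ^ (n * x n)) atTop (𝓝 0) :=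
  (ENNReal.tendsto_rpow_atBot_of_one_lt_base ENNReal.one_lt_two).comp
    (tendsto_natCast_atTop_atTop.atTop_mul_neg hl hx)

theorem natCast_eq_two_rpow {n k : ℕ} (hn : 0 < n) (hk : 0 < k) :
    (k : ℝ≥0∞) = 2 ^ (n * (Real.logb 2 k / n)) := by
  rw [mul_div_cancel₀ _ (Nat.cast_ne_zero.2 hn.ne'), ← ENNReal.toReal_natCast k,
    two_rpow_logb_toReal (Nat.cast_ne_zero.2 hk.ne') (ENNReal.natCast_ne_top k)]

namespace HasRate

variable {k l : ℕ → ℕ} {ρ θ : ℝ}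

theorem mul {σ : ℝ} (hk : ∀ n, 0 < k n) (hl : ∀ n, 0 < l n) (hkρ : HasRate k ρ)
    (hlσ : HasRate l σ) : HasRate (fun n => k n * l n) (ρ + σ) := by
  refine (hkρ.add hlσ).congr fun n => ?_
  rw [Nat.cast_mul, Real.logb_mul (Nat.cast_ne_zero.2 (hk n).ne')
    (Nat.cast_ne_zero.2 (hl n).ne'), add_div]

theorem prod {ι : Type*} {K : ι → ℕ → ℕ} {ρ : ι → ℝ} (O : Finset ι) (hK : ∀ i n, 0 < K i n)
    (hKρ : ∀ i, HasRate (K i) (ρ i)) : HasRate (fun n => ∏ i ∈ O, K i n) (∑ i ∈ O, ρ i) := by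
  refine (tendsto_finsetSum O fun i _ => hKρ i).congr fun n => ?_
  rw [Nat.cast_prod, Real.logb_prod _ _ fun i _ => Nat.cast_ne_zero.2 (hK i n).ne',
    Finset.sum_div]

theorem tendsto_mul_two_rpow_neg (hk : ∀ n, 0 < k n) (hkρ : HasRate k ρ) (hθ : ρ < θ) :
    Tendsto (fun n : ℕ => k n * (2 : ℝ≥0∞) ^ (-(n * θ))) atTop (𝓝 0) := by
  refine (tendsto_two_rpow_mul_of_neg (hkρ.sub_const θ) (sub_neg.2 hθ)).congr' ?_
  filter_upwards [eventually_gt_atTop 0] with n hn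
  rw [natCast_eq_two_rpow hn (hk n), ← ENNReal.rpow_add _ _ two_ne_zero ENNReal.ofNat_ne_top,
    mul_sub, sub_eq_add_neg]

theorem tendsto_two_rpow_mul_inv (hk : ∀ n, 0 < k n) (hkρ : HasRate k ρ) (hθ : θ < ρ) :
    Tendsto (fun n : ℕ => (2 : ℝ≥0∞) ^ (n * θ) * (k n : ℝ≥0∞)⁻¹) atTop (𝓝 0) := by
  refine (tendsto_two_rpow_mul_of_neg (hkρ.const_sub θ) (sub_neg.2 hθ)).congr' ?_
  filter_upwards [eventually_gt_atTop 0] with n hn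
  rw [natCast_eq_two_rpow hn (hk n), ← ENNReal.rpow_neg,
    ← ENNReal.rpow_add _ _ two_ne_zero ENNReal.ofNat_ne_top, mul_sub, sub_eq_add_neg]

end HasRate

theorem tendsto_prod_one {ι : Type*} (O : Finset ι) {a : ℕ → ι → ℝ≥0∞}
    (ha : ∀ i, Tendsto (fun n => a n i) atTop (𝓝 1)) :
    Tendsto (fun n => ∏ i ∈ O, a n i) atTop (𝓝 1) := by
  simpa only [Finset.prod_const_one] using
    ENNReal.tendsto_finsetProd_of_ne_top O (fun i _ => ha i) fun _ _ => ENNReal.one_ne_top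

theorem tendsto_mul_zero_of_tendsto_one {x y : ℕ → ℝ≥0∞} (hx : Tendsto x atTop (𝓝 1))
    (hy : Tendsto y atTop (𝓝 0)) : Tendsto (fun n => x n * y n) atTop (𝓝 0) := by
  simpa only [mul_zero] using
    ENNReal.Tendsto.mul hx (Or.inr ENNReal.zero_ne_top) hy (Or.inr ENNReal.one_ne_top)

variable {S : Type*} (T : Finset S) {ρ : S → ℝ}

theorem secondMomentBound_eq_sum [DecidableEq S] (Γ : S → Type*) [∀ s, Fintype (Γ s)]
    [∀ s, Nonempty (Γ s)] (a b : S → ℝ≥0∞) (B : Finset T → ℝ≥0∞) :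
    secondMomentBound T Γ a b B = ∑ O : Finset T, (∏ s ∈ Oᶜ, a s) * ((∏ s ∈ O, (1 + b s)) *
      (((∏ s ∈ O, Fintype.card (Γ s) : ℕ) : ℝ≥0∞) * B O)) := by
  rw [secondMomentBound, Fintype.card_pi, Finset.mul_sum]
  refine Finset.sum_congr rfl fun O _ => ?_
  have hcompl : ∏ s ∈ Oᶜ, a s =
      (∏ s ∈ Oᶜ, (Fintype.card (Γ s) : ℝ≥0∞)) * ∏ s ∈ Oᶜ, a s / Fintype.card (Γ s) := by
    rw [← Finset.prod_mul_distrib]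
    exact Finset.prod_congr rfl fun s _ => (ENNReal.mul_div_cancel
      (Nat.cast_ne_zero.2 Fintype.card_ne_zero) (ENNReal.natCast_ne_top _)).symm
  rw [hcompl, ← Finset.prod_compl_mul_prod O]
  push_cast
  ring

variable {Γ : ℕ → S → Type*} [∀ n s, Fintype (Γ n s)] [∀ n s, Nonempty (Γ n s)]
  (hΓ : ∀ s, HasRate (fun n => Fintype.card (Γ n s)) (ρ s)) {a b : ℕ → S → ℝ≥0∞}
  (ha : ∀ s, Tendsto (fun n => a n s) atTop (𝓝 1)) (hb : ∀ s, Tendsto (fun n => b n s) atTop (𝓝 0))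

include hΓ ha hb

theorem tendsto_secondMomentBound [DecidableEq S] {θ : Finset T → ℝ} (hθ₀ : θ ∅ = 0)
    (hθ : ∀ O : Finset T, O.Nonempty → ∑ s ∈ O, ρ s < θ O) :
    Tendsto (fun n : ℕ => secondMomentBound T (Γ n) (a n) (b n) fun O => 2 ^ (-(n * θ O))) atTop
      (𝓝 1) := by
  have hterm (O : Finset T) : Tendsto (fun n : ℕ => (∏ s ∈ Oᶜ, a n s) * ((∏ s ∈ O, (1 + b n s)) *
      (((∏ s ∈ O, Fintype.card (Γ n s) : ℕ) : ℝ≥0∞) * 2 ^ (-(n * θ O))))) atTop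
      (𝓝 (if O = ∅ then 1 else 0)) := by
    split_ifs with hO
    · subst hO
      simpa [hθ₀] using tendsto_prod_one Finset.univ fun s : T => ha s
    · refine tendsto_mul_zero_of_tendsto_one (tendsto_prod_one _ fun s => ha s)
        (tendsto_mul_zero_of_tendsto_one (tendsto_prod_one _ fun s => ?_) ?_)
      · simpa only [add_zero] using (hb s).const_add 1
      · exact (HasRate.prod O (fun _ _ => Fintype.card_pos) fun s : T => hΓ s)
          |>.tendsto_mul_two_rpow_neg (fun n => Finset.prod_pos fun _ _ => Fintype.card_pos)
          (hθ O (Finset.nonempty_iff_ne_empty.2 hO))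
  simpa only [secondMomentBound_eq_sum, Finset.sum_ite_eq', Finset.mem_univ, if_true] using
    tendsto_finsetSum Finset.univ fun O _ => hterm O

theorem tendsto_collisionBound {ν : Finset T → ℝ}
    (hν : ∀ O : Finset T, O.Nonempty → ν O < ∑ s ∈ O, ρ s) :
    Tendsto (fun n : ℕ => collisionBound T (Γ n) (a n) (b n) fun O => 2 ^ (n * ν O)) atTop
      (𝓝 0) := by
  have hexceptional : Tendsto (fun n => ∑ s : T, b n s) atTop (𝓝 0) := by
    simpa only [Finset.sum_const_zero] using tendsto_finsetSum Finset.univ fun (s : T) _ => hb s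
  have hterm (O : Finset T) (hO : O.Nonempty) : Tendsto (fun n : ℕ =>
      (2 : ℝ≥0∞) ^ (n * ν O) * ∏ s ∈ O, a n s / Fintype.card (Γ n s)) atTop (𝓝 0) := by
    refine (tendsto_mul_zero_of_tendsto_one (tendsto_prod_one O fun s => ha s)
      ((HasRate.prod O (fun _ _ => Fintype.card_pos) fun s : T => hΓ s)
        |>.tendsto_two_rpow_mul_inv (fun n => Finset.prod_pos fun _ _ => Fintype.card_pos)
          (hν O hO))).congr fun n => ?_
    rw [ENNReal.prod_div_distrib_of_ne_top fun _ _ => ENNReal.natCast_ne_top _, Nat.cast_prod,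
      mul_left_comm, div_eq_mul_inv]
  simpa only [collisionBound, Finset.sum_const_zero, add_zero] using hexceptional.add
    (tendsto_finsetSum _ fun O hO => hterm O (Finset.mem_filter.1 hO).2)

theorem tendsto_deficitBound [DecidableEq S] {Z : ℕ → S → Type*}
    [∀ n s, MeasurableSpace (Z n s)] {μ : ∀ n, Measure (∀ s, Z n s)} (T' : Finset S)
    {θ : Finset T → ℝ} (hθ₀ : θ ∅ = 0) (hθ : ∀ O : Finset T, O.Nonempty → ∑ s ∈ O, ρ s < θ O)
    (hμ : Tendsto (fun n : ℕ => μ n {z | T.restrict z ∉ condTypical (μ n) T T'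
      (fun O => 2 ^ (-(n * θ O))) (T'.restrict z)}) atTop (𝓝 0)) :
    Tendsto (fun n : ℕ => deficitBound (μ n) T T' (Γ n) (a n) (b n) fun O => 2 ^ (-(n * θ O)))
      atTop (𝓝 0) := by
  have hbase := ENNReal.Tendsto.sub ((tendsto_secondMomentBound T hΓ ha hb hθ₀ hθ).add
    (ENNReal.Tendsto.const_mul hμ (Or.inr ENNReal.ofNat_ne_top : _ ∨ (2 : ℝ≥0∞) ≠ ∞)))
    (tendsto_const_nhds (x := 1)) (Or.inr ENNReal.one_ne_top)
  simpa [deficitBound] using hμ.add (hbase.ennrpow_const (1 / 2 : ℝ))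

end Rates

/-! ### Information densities and spectral entropy rates -/

section Spectral

variable {Ω α β : ℕ → Type*} [∀ n, MeasurableSpace (Ω n)]
  [∀ n, MeasurableSpace (α n)] [∀ n, Countable (α n)] [∀ n, MeasurableSingletonClass (α n)]
  [∀ n, Nonempty (α n)] [∀ n, MeasurableSpace (β n)]
  {P : ∀ n, Measure (Ω n)} [∀ n, IsFiniteMeasure (P n)]
  {U : ∀ n, Ω n → α n} {V : ∀ n, Ω n → β n}

theorem two_rpow_neg_mul_condInformation {n : ℕ} (hn : 0 < n) {ω : Ω n}
    (hω : condDistrib (U n) (V n) (P n) (V n ω) {U n ω} ≠ 0) :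
    (2 : ℝ≥0∞) ^ (-(n * condInformation P U V n ω)) =
      condDistrib (U n) (V n) (P n) (V n ω) {U n ω} := by
  rw [condInformation, ← mul_assoc, mul_one_div_cancel (Nat.cast_ne_zero.2 hn.ne'), one_mul,
    one_div, Real.logb_inv, neg_neg]
  exact two_rpow_logb_toReal hω (measure_ne_top _ _)

theorem exists_tendsto_of_lt_spectralInf {x : ℝ} (hx : (x : EReal) < spectralInf P U V) :
    ∃ θ : ℝ, x < θ ∧ Tendsto (fun n : ℕ => P n {ω | 2 ^ (-(n * θ)) <
      condDistrib (U n) (V n) (P n) (V n ω) {U n ω}}) atTop (𝓝 0) := by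
  obtain ⟨θ', hθ', hlt⟩ := lt_sSup_iff.1 hx
  obtain ⟨θ, hxθ, hθ⟩ := EReal.lt_iff_exists_real_btwn.1 hlt
  refine ⟨θ, EReal.coe_lt_coe_iff.1 hxθ, ?_⟩
  refine tendsto_of_tendsto_of_tendsto_of_le_of_le' tendsto_const_nhds hθ'
    (Eventually.of_forall fun _ => zero_le) ?_
  filter_upwards [eventually_gt_atTop 0] with n hn
  refine measure_mono fun ω hω => lt_trans (EReal.coe_lt_coe_iff.2 ?_) hθ
  by_contra! hle
  rw [Set.mem_ofPred_eq] at hω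
  refine hω.not_ge ?_
  rw [← two_rpow_neg_mul_condInformation hn hω.ne_bot]
  gcongr
  exact one_le_two

theorem exists_tendsto_of_spectralSup_lt (hU : ∀ n, Measurable (U n)) (hV : ∀ n, Measurable (V n))
    {x : ℝ} (hx : spectralSup P U V < (x : EReal)) :
    ∃ θ : ℝ, θ < x ∧ Tendsto (fun n : ℕ => P n {ω | condDistrib (U n) (V n) (P n) (V n ω) {U n ω} <
      (2 ^ (n * θ))⁻¹}) atTop (𝓝 0) := by
  obtain ⟨θ', hθ', hlt⟩ := sInf_lt_iff.1 hx
  obtain ⟨θ, hθ, hθx⟩ := EReal.lt_iff_exists_real_btwn.1 hlt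
  refine ⟨θ, EReal.coe_lt_coe_iff.1 hθx, ?_⟩
  refine tendsto_of_tendsto_of_tendsto_of_le_of_le' tendsto_const_nhds hθ'
    (Eventually.of_forall fun _ => zero_le) ?_
  filter_upwards [eventually_gt_atTop 0] with n hn
  refine measure_mono_ae ?_
  have hpos : ∀ᵐ ω ∂P n, condDistrib (U n) (V n) (P n) (V n ω) {U n ω} ≠ 0 := by
    simpa only [ae_iff, not_not] using measure_condDistrib_singleton_eq_zero (hU n) (hV n)
  filter_upwards [hpos] with ω h0 hω
  refine lt_trans hθ (EReal.coe_lt_coe_iff.2 ?_)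
  by_contra! hle
  refine hω.not_ge ?_
  rw [← two_rpow_neg_mul_condInformation hn h0, ← ENNReal.rpow_neg]
  gcongr
  exact one_le_two

end Spectral

section Typicality

variable {S : Type*} [Finite S] {Z : ℕ → S → Type*}
  [∀ n s, MeasurableSpace (Z n s)] [∀ n s, Countable (Z n s)]
  [∀ n s, MeasurableSingletonClass (Z n s)] [∀ n s, Nonempty (Z n s)]
  {Ω : ℕ → Type*} [∀ n, MeasurableSpace (Ω n)] {P : ∀ n, Measure (Ω n)}
  [∀ n, IsProbabilityMeasure (P n)] {ζ : ∀ n, Ω n → ∀ s, Z n s} {T : Finset S} {ρ : S → ℝ}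

theorem exists_tendsto_measure_notMem_condTypical {μ : ∀ n, Measure (∀ s, Z n s)}
    (hζ : ∀ n, MeasurePreserving (ζ n) (P n) (μ n)) (T' : Finset S)
    (h : ∀ S' ⊆ T, S'.Nonempty → ((∑ s ∈ S', ρ s : ℝ) : EReal) <
      spectralInf P (fun n ω => S'.restrict (ζ n ω)) (fun n ω => T'.restrict (ζ n ω))) :
    ∃ θ : Finset T → ℝ, θ ∅ = 0 ∧ (∀ O : Finset T, O.Nonempty → ∑ s ∈ O, ρ s < θ O) ∧
      Tendsto (fun n : ℕ => μ n {z | T.restrict z ∉ condTypical (μ n) T T'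
        (fun O => 2 ^ (-(n * θ O))) (T'.restrict z)}) atTop (𝓝 0) := by
  have hexists (O : Finset T) : ∃ x : ℝ, (O = ∅ → x = 0) ∧ (O.Nonempty → ∑ s ∈ O, ρ s < x ∧
      Tendsto (fun n : ℕ => P n {ω | 2 ^ (-(n * x)) <
        condDistrib (fun ω => (liftFinset O).restrict (ζ n ω)) (fun ω => T'.restrict (ζ n ω)) (P n)
          (T'.restrict (ζ n ω)) {(liftFinset O).restrict (ζ n ω)}}) atTop (𝓝 0)) := by
    rcases O.eq_empty_or_nonempty with rfl | hO
    · exact ⟨0, fun _ => rfl, fun h => absurd h Finset.not_nonempty_empty⟩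
    · obtain ⟨x, hx, hlim⟩ := exists_tendsto_of_lt_spectralInf
        (h (liftFinset O) (liftFinset_subset O) hO.map)
      exact ⟨x, fun h => absurd h hO.ne_empty, fun _ => ⟨sum_liftFinset O ρ ▸ hx, hlim⟩⟩
  choose θ hθ₀ hθ using hexists
  refine ⟨θ, hθ₀ ∅ rfl, fun O hO => (hθ O hO).1, ?_⟩
  have hsum := tendsto_finsetSum (Finset.univ.filter Finset.Nonempty) fun O hO =>
    (hθ O (Finset.mem_filter.1 hO).2).2
  rw [Finset.sum_const_zero] at hsum
  exact tendsto_of_tendsto_of_tendsto_of_le_of_le tendsto_const_nhds hsum (fun _ => zero_le)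
    fun n => measure_notMem_condTypical_le (hζ n) T T' (by simp [hθ₀])

variable [DecidableEq S] {Γ : ℕ → S → Type*} [∀ n s, Fintype (Γ n s)] [∀ n s, Nonempty (Γ n s)]
  (hΓ : ∀ s, HasRate (fun n => Fintype.card (Γ n s)) (ρ s)) {a b : ℕ → S → ℝ≥0∞}
  (ha : ∀ s, Tendsto (fun n => a n s) atTop (𝓝 1)) (hb : ∀ s, Tendsto (fun n => b n s) atTop (𝓝 0))

include hΓ ha hb

theorem exists_tendsto_deficitBound {μ : ∀ n, Measure (∀ s, Z n s)}
    (hζ : ∀ n, MeasurePreserving (ζ n) (P n) (μ n)) (T' : Finset S)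
    (h : ∀ S' ⊆ T, S'.Nonempty → ((∑ s ∈ S', ρ s : ℝ) : EReal) <
      spectralInf P (fun n ω => S'.restrict (ζ n ω)) (fun n ω => T'.restrict (ζ n ω))) :
    ∃ B : ℕ → Finset T → ℝ≥0∞,
      Tendsto (fun n => deficitBound (μ n) T T' (Γ n) (a n) (b n) (B n)) atTop (𝓝 0) := by
  obtain ⟨θ, hθ₀, hθ, hlim⟩ := exists_tendsto_measure_notMem_condTypical hζ T' h
  exact ⟨_, tendsto_deficitBound T hΓ ha hb T' hθ₀ hθ hlim⟩

theorem exists_tendsto_collisionBound {Y : ℕ → Type*} [∀ n, MeasurableSpace (Y n)]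
    {η : ∀ n, Ω n → Y n} (hζ : ∀ n, Measurable (ζ n)) (hη : ∀ n, Measurable (η n))
    (h : ∀ S' ⊆ T, S'.Nonempty →
      spectralSup P (fun n ω => S'.restrict (ζ n ω))
        (fun n ω => (η n ω, (T \ S').restrict (ζ n ω))) < ((∑ s ∈ S', ρ s : ℝ) : EReal)) :
    ∃ N : ℕ → Finset T → ℝ≥0∞, Tendsto (fun n =>
      2 * P n {ω | (η n ω, T.restrict (ζ n ω)) ∉ posteriorTypical (P n) (ζ n) (η n) T (N n)} +
        collisionBound T (Γ n) (a n) (b n) (N n)) atTop (𝓝 0) := by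
  have hmeas (n : ℕ) (R : Finset S) : Measurable fun ω => R.restrict (ζ n ω) :=
    (Finset.measurable_restrict R).comp (hζ n)
  choose! ν hν hlim using fun (O : Finset T) (hO : O.Nonempty) =>
    exists_tendsto_of_spectralSup_lt (fun n => hmeas n (liftFinset O))
      (fun n => (hη n).prodMk (hmeas n (T \ liftFinset O)))
      (h (liftFinset O) (liftFinset_subset O) hO.map)
  refine ⟨fun n O => 2 ^ (n * ν O), ?_⟩
  have hcoll := tendsto_collisionBound T hΓ ha hb fun O hO => sum_liftFinset O ρ ▸ hν O hO
  have hsum := tendsto_finsetSum (Finset.univ.filter Finset.Nonempty) fun O hO =>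
    hlim O (Finset.mem_filter.1 hO).2
  rw [Finset.sum_const_zero] at hsum
  have htyp := tendsto_of_tendsto_of_tendsto_of_le_of_le tendsto_const_nhds hsum
    (fun _ => zero_le) fun n => measure_notMem_posteriorTypical_le T fun O => 2 ^ (n * ν O)
  simpa only [mul_zero, add_zero] using
    (ENNReal.Tendsto.const_mul htyp (Or.inr ENNReal.ofNat_ne_top)).add hcoll

end Typicality

/-! ### Random binning -/

section Binning

/-- Random binning: the ensemble of all functions, with independent and uniform values. -/
def binningEnsemble (α γ : Type*) [Fintype γ] [Nonempty γ] [MeasurableSpace γ] : Ensemble α γ where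
  funs := Set.univ
  law := Measure.infinitePi fun _ => (PMF.uniformOfFintype γ).toMeasure
  isProbabilityMeasure := inferInstance
  ae_mem := Eventually.of_forall fun _ => Set.mem_univ _

namespace binningEnsemble

variable {α γ : Type*} [Fintype γ] [Nonempty γ] [MeasurableSpace γ]

theorem im_eq_univ [Nonempty α] : (binningEnsemble α γ).im = Set.univ :=
  Set.eq_univ_of_forall fun y =>
    Set.mem_biUnion (Set.mem_univ fun _ => y) ⟨Classical.arbitrary α, rfl⟩

variable [MeasurableSingletonClass γ]

theorem law_collision_le {x x' : α} (hne : x' ≠ x) :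
    (binningEnsemble α γ).law {f | f x = f x'} ≤ (Fintype.card γ : ℝ≥0∞)⁻¹ := by
  classical
  have hset : {f : α → γ | f x = f x'} =
      ⋃ y ∈ (Finset.univ : Finset γ), Set.pi (({x, x'} : Finset α) : Set α) fun _ => {y} := by
    ext f
    simp [eq_comm]
  have hpair (y : γ) :
      (binningEnsemble α γ).law (Set.pi (({x, x'} : Finset α) : Set α) fun _ => {y}) =
        (Fintype.card γ : ℝ≥0∞)⁻¹ * (Fintype.card γ : ℝ≥0∞)⁻¹ := by
    refine (Measure.infinitePi_pi (fun _ : α => (PMF.uniformOfFintype γ).toMeasure)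
      fun _ _ => measurableSet_singleton y).trans ?_
    rw [Finset.prod_pair hne.symm,
      PMF.toMeasure_apply_singleton _ _ (measurableSet_singleton y), PMF.uniformOfFintype_apply]
  calc (binningEnsemble α γ).law {f | f x = f x'}
      ≤ ∑ y : γ, (binningEnsemble α γ).law
          (Set.pi (({x, x'} : Finset α) : Set α) fun _ => {y}) := by
        rw [hset]
        exact measure_biUnion_finset_le _ _
    _ = (Fintype.card γ : ℝ≥0∞)⁻¹ := by
        simp only [hpair, Finset.sum_const, Finset.card_univ, nsmul_eq_mul]
        rw [← mul_assoc, ENNReal.mul_inv_cancel (Nat.cast_ne_zero.2 Fintype.card_ne_zero)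
          (ENNReal.natCast_ne_top _), one_mul]

theorem isHash [Nonempty α] : (binningEnsemble α γ).IsHash 1 0 := by
  classical
  intro x
  refine (ENNReal.tsum_eq_zero.2 fun x' => if_neg ?_).le
  rintro ⟨hne, hlt⟩
  rw [im_eq_univ, Set.ncard_univ, Nat.card_eq_fintype_card, ENNReal.coe_one, one_div] at hlt
  exact (law_collision_le hne).not_gt hlt

theorem hasHashProperty {α γ : ℕ → Type*} [∀ n, Nonempty (α n)]
    [∀ n, Fintype (γ n)] [∀ n, Nonempty (γ n)] [∀ n, MeasurableSpace (γ n)]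
    [∀ n, MeasurableSingletonClass (γ n)] :
    HasHashProperty fun n => binningEnsemble (α n) (γ n) :=
  ⟨fun _ => 1, fun _ => 0, tendsto_const_nhds, tendsto_const_nhds, fun _ => isHash⟩

end binningEnsemble

end Binning

theorem measurePreserving_fst_jointLaw {S I J : Type*} [Fintype S] [Fintype I] [DecidableEq S]
    [DecidableEq I] {Z : S → Type*} {X : I → Type*} {Y : J → Type*}
    [∀ s, MeasurableSpace (Z s)] [∀ i, MeasurableSpace (X i)] [∀ j, MeasurableSpace (Y j)]
    [∀ s, Countable (Z s)] [∀ s, MeasurableSingletonClass (Z s)] (A : Finset (S × I))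
    (μ : Measure (∀ s, Z s)) [SFinite μ] (W : ∀ i, Kernel (∀ s : messagesOf A i, Z s) (X i))
    [∀ i, IsMarkovKernel (W i)] (V : Kernel (∀ i, X i) (∀ j, Y j)) [IsMarkovKernel V] :
    MeasurePreserving Prod.fst (jointLaw A μ W V) μ :=
  ⟨measurable_fst, Measure.fst_compProd μ _⟩

section CodingTheorem

variable {S I J : Type*} [Fintype S] [Fintype I] [Fintype J] [DecidableEq S] [DecidableEq I]
  {A : Finset (S × I)} {L : List (Finset I)} (hL : IsReverseLinearExtension A L) {D : J → Finset S}
  {Z : ℕ → S → Type*} [∀ n s, MeasurableSpace (Z n s)] [∀ n s, Countable (Z n s)]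
  [∀ n s, MeasurableSingletonClass (Z n s)] [∀ n s, Nonempty (Z n s)]
  {X : ℕ → I → Type*} [∀ n i, MeasurableSpace (X n i)]
  {Y : ℕ → J → Type*} [∀ n j, MeasurableSpace (Y n j)]
  {μ : ∀ n, Measure (∀ s, Z n s)} [∀ n, IsProbabilityMeasure (μ n)]
  (hμ : ∀ n, IsConsistent A (μ n))
  {W : ∀ n i, Kernel (∀ s : messagesOf A i, Z n s) (X n i)} [∀ n i, IsMarkovKernel (W n i)]
  {V : ∀ n, Kernel (∀ i, X n i) (∀ j, Y n j)} [∀ n, IsMarkovKernel (V n)] {r R : S → ℝ}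
  (hEnc : ∀ I' ∈ accessFamily A, ∀ S' ⊆ privateMessages A I', S'.Nonempty →
    ((∑ s ∈ S', (R s + r s) : ℝ) : EReal) <
      spectralInf (fun n => jointLaw A (μ n) (W n) (V n))
        (fun _ ω => S'.restrict ω.1) (fun _ ω => (publicMessages A I').restrict ω.1))
  (hDec : ∀ j, ∀ D' ⊆ D j, D'.Nonempty →
    spectralSup (fun n => jointLaw A (μ n) (W n) (V n))
        (fun _ ω => D'.restrict ω.1) (fun _ ω => (ω.2.2 j, (D j \ D').restrict ω.1)) <
      ((∑ s ∈ D', r s : ℝ) : EReal))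
  {C M : ℕ → S → Type*} [∀ n s, Fintype (C n s)] [∀ n s, Nonempty (C n s)]
  [∀ n s, MeasurableSpace (C n s)] [∀ n s, MeasurableSingletonClass (C n s)]
  [∀ n s, Fintype (M n s)] [∀ n s, Nonempty (M n s)]
  [∀ n s, MeasurableSpace (M n s)] [∀ n s, MeasurableSingletonClass (M n s)]
  (hC : ∀ s, HasRate (fun n => Fintype.card (C n s)) (r s))
  (hM : ∀ s, HasRate (fun n => Fintype.card (M n s)) (R s))

include hL hμ hEnc hDec hC hM

theorem eventually_exists_code_of_hasHashProperty
    {F : ∀ s n, Ensemble (Z n s) (C n s)} {G : ∀ s n, Ensemble (Z n s) (M n s)}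
    (hFim : ∀ s n, (F s n).im = Set.univ) (hGim : ∀ s n, (G s n).im = Set.univ)
    (hF : ∀ s, HasHashProperty (F s)) (hG : ∀ s, HasHashProperty (G s))
    {δ : ℝ} (hδ : 0 < δ) :
    ∀ᶠ n in atTop, ∃ (f : ∀ s, Z n s → C n s) (g : ∀ s, Z n s → M n s) (c : ∀ s, C n s),
      (∀ s, f s ∈ (F s n).funs) ∧ (∀ s, g s ∈ (G s n).funs) ∧
        errorProb A L D (μ n) (W n) (V n) f g c ≤ ENNReal.ofReal δ := by
  choose a b ha hb hFhash using hF
  choose a' b' ha' hb' hGhash using hG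
  have hfst (n : ℕ) := measurePreserving_fst_jointLaw A (μ n) (W n) (V n)
  have hCM (s : S) : HasRate (fun n => Fintype.card (C n s × M n s)) (R s + r s) := by
    simp only [Fintype.card_prod, add_comm (R s)]
    exact (hC s).mul (fun _ => Fintype.card_pos) (fun _ => Fintype.card_pos) (hM s)
  choose! B hB using fun I' (hI' : I' ∈ accessFamily A) =>
    exists_tendsto_deficitBound hCM
      (a := fun n s => a s n * a' s n) (b := fun n s => b s n + b' s n)
      (fun s => by simpa using ENNReal.tendsto_coe.2 ((ha s).mul (ha' s)))
      (fun s => by simpa using ENNReal.tendsto_coe.2 ((hb s).add (hb' s)))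
      hfst (publicMessages A I') (hEnc I' hI')
  choose N hN using fun j => exists_tendsto_collisionBound hC
    (fun s => ENNReal.tendsto_coe.2 (ha s)) (fun s => ENNReal.tendsto_coe.2 (hb s))
    (fun n => (hfst n).measurable)
    (fun n => (measurable_pi_apply j).comp (measurable_snd.comp measurable_snd)) (hDec j)
  have herror := (tendsto_finsetSum Finset.univ fun j _ => hN j).add
    (tendsto_finsetSum (accessFamily A) hB)
  simp only [Finset.sum_const_zero, add_zero] at herror
  filter_upwards [herror.eventually_le_const (ENNReal.ofReal_pos.2 hδ)] with n hn
  obtain ⟨f, g, c, hf, hg, hle⟩ := exists_code_le A D (μ n) (W n) (V n) L hL (hμ n)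
    (fun s => hFhash s n) (fun s => hFim s n) (fun s => hGhash s n) (fun s => hGim s n)
    (fun j => posteriorTypical (jointLaw A (μ n) (W n) (V n)) Prod.fst (fun ω => ω.2.2 j) (D j)
      (N j n))
    (fun j => measurableSet_posteriorTypical (D j) (N j n))
    (fun j => N j n) (fun j y w O hO => encard_posteriorTypical_le (D j) (N j n) y w hO)
    fun I' => B I' n
  exact ⟨f, g, c, hf, hg, hle.trans hn⟩

theorem theorem2_general :
    (∀ δ : ℝ, 0 < δ → ∀ᶠ n in atTop,
      ∃ (f : ∀ s, Z n s → C n s) (g : ∀ s, Z n s → M n s) (c : ∀ s, C n s),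
        errorProb A L D (μ n) (W n) (V n) f g c ≤ ENNReal.ofReal δ) ∧
    (∀ (F : ∀ s n, Ensemble (Z n s) (C n s)) (G : ∀ s n, Ensemble (Z n s) (M n s)),
      (∀ s n, (F s n).im = Set.univ) → (∀ s n, (G s n).im = Set.univ) →
      (∀ s, HasHashProperty (F s)) → (∀ s, HasHashProperty (G s)) →
      ∀ δ : ℝ, 0 < δ → ∀ᶠ n in atTop,
        ∃ (f : ∀ s, Z n s → C n s) (g : ∀ s, Z n s → M n s) (c : ∀ s, C n s),
          (∀ s, f s ∈ (F s n).funs) ∧ (∀ s, g s ∈ (G s n).funs) ∧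
          errorProb A L D (μ n) (W n) (V n) f g c ≤ ENNReal.ofReal δ) := by
  refine ⟨fun δ hδ => ?_, fun F G hFim hGim hF hG δ hδ =>
    eventually_exists_code_of_hasHashProperty hL hμ hEnc hDec hC hM hFim hGim hF hG hδ⟩
  refine (eventually_exists_code_of_hasHashProperty hL hμ hEnc hDec hC hM
    (fun _ _ => binningEnsemble.im_eq_univ) (fun _ _ => binningEnsemble.im_eq_univ)
    (fun _ => binningEnsemble.hasHashProperty) (fun _ => binningEnsemble.hasHashProperty)
    hδ).mono ?_
  rintro n ⟨f, g, c, -, -, hle⟩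
  exact ⟨f, g, c, hle⟩

end CodingTheorem

end RelaylessNetwork

end

open RelaylessNetwork in
theorem theorem2
    {S I J : Type*} [Fintype S] [Fintype I] [Fintype J] [DecidableEq S] [DecidableEq I]
    -- the access structure, a linear extension, and the sets of messages wanted by the decoders
    (A : Finset (S × I)) (L : List (Finset I)) (hL : IsReverseLinearExtension A L)
    (D : J → Finset S)
    -- the alphabets of sources, channel inputs and channel outputs
    (Z : ℕ → S → Type*) [∀ n s, MeasurableSpace (Z n s)] [∀ n s, Countable (Z n s)]
    [∀ n s, MeasurableSingletonClass (Z n s)] [∀ n s, Nonempty (Z n s)]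
    (X : I → Type*) [∀ i, Finite (X i)] [∀ i, MeasurableSpace (X i)]
    [∀ i, MeasurableSingletonClass (X i)]
    (Y : ℕ → J → Type*) [∀ n j, MeasurableSpace (Y n j)]
    -- the laws of the sources and of the channel inputs, and the channel
    (μ : ∀ n, Measure (∀ s, Z n s)) [∀ n, IsProbabilityMeasure (μ n)]
    (hμ : ∀ n, IsConsistent A (μ n))
    (W : ∀ n i, Kernel (∀ s : messagesOf A i, Z n s) (Fin n → X i))
    [∀ n i, IsMarkovKernel (W n i)]
    (V : ∀ n, Kernel (∀ i, Fin n → X i) (∀ j, Y n j)) [∀ n, IsMarkovKernel (V n)]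
    -- the rates
    (r R : S → ℝ) (hR : ∀ s, 0 ≤ R s)
    (hEnc : ∀ I' ∈ accessFamily A, ∀ S' ⊆ privateMessages A I', S'.Nonempty →
      ((∑ s ∈ S', (R s + r s) : ℝ) : EReal) <
        spectralInf (fun n => jointLaw A (μ n) (W n) (V n))
          (fun _ ω => S'.restrict ω.1) (fun _ ω => (publicMessages A I').restrict ω.1))
    (hDec : ∀ j, ∀ D' ⊆ D j, D'.Nonempty →
      spectralSup (fun n => jointLaw A (μ n) (W n) (V n))
          (fun _ ω => D'.restrict ω.1) (fun _ ω => (ω.2.2 j, (D j \ D').restrict ω.1)) <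
        ((∑ s ∈ D', r s : ℝ) : EReal))
    -- the ranges of the functions `f_s` and the sets of messages, of rates `r_s` and `R_s`
    (C M : ℕ → S → Type*) [∀ n s, Fintype (C n s)] [∀ n s, Nonempty (C n s)]
    [∀ n s, MeasurableSpace (C n s)] [∀ n s, MeasurableSingletonClass (C n s)]
    [∀ n s, Fintype (M n s)] [∀ n s, Nonempty (M n s)]
    [∀ n s, MeasurableSpace (M n s)] [∀ n s, MeasurableSingletonClass (M n s)]
    (hC : ∀ s, Tendsto (fun n : ℕ => Real.logb 2 (Fintype.card (C n s)) / n) atTop (𝓝 (r s)))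
    (hM : ∀ s, Tendsto (fun n : ℕ => Real.logb 2 (Fintype.card (M n s)) / n) atTop (𝓝 (R s))) :
    (∀ δ : ℝ, 0 < δ → ∀ᶠ n in atTop,
      ∃ (f : ∀ s, Z n s → C n s) (g : ∀ s, Z n s → M n s) (c : ∀ s, C n s),
        errorProb A L D (μ n) (W n) (V n) f g c ≤ ENNReal.ofReal δ) ∧
    (∀ (F : ∀ s n, Ensemble (Z n s) (C n s)) (G : ∀ s n, Ensemble (Z n s) (M n s)),
      (∀ s n, (F s n).im = Set.univ) → (∀ s n, (G s n).im = Set.univ) →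
      (∀ s, HasHashProperty (F s)) → (∀ s, HasHashProperty (G s)) →
      ∀ δ : ℝ, 0 < δ → ∀ᶠ n in atTop,
        ∃ (f : ∀ s, Z n s → C n s) (g : ∀ s, Z n s → M n s) (c : ∀ s, C n s),
          (∀ s, f s ∈ (F s n).funs) ∧ (∀ s, g s ∈ (G s n).funs) ∧
          errorProb A L D (μ n) (W n) (V n) f g c ≤ ENNReal.ofReal δ) :=
  theorem2_general hL hμ hEnc hDec hC hM
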